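/- Let $n\in\mathbb N$, let $\Theta$ be a real skew-symmetric $n\times n$ matrix and $m=\lfloor n/2\rfloor$. Let $\mathcal A=C^\infty(\mathbb T^n_\Theta)$ be the smooth noncommutative torus, i.e. the algebra of the series $a=\sum_{k\in\mathbb Z^n}a_kU_k$ with Schwartz coefficients $(a_k)$ and unitaries $U_k$ satisfying $U_kU_q=e^{-\frac i2k\cdot\Theta q}U_{k+q}$, $U_k^*=U_{-k}$. Put $\tau(\sum_ka_kU_k)=a_0$, let $\mathcal H_\tau$ be the GNS Hilbert space of $\tau$ (with orthonormal basis $(U_k)$), let $L$ be the left regular representation, and let $\mathcal A$ act on $\mathcal H=\mathcal H_\tau\otimes\mathbb C^{2^m}$ by $a\mapsto L(a)\otimes 1$. Let $\gamma^1,\dots,\gamma^n$ be hermitian $2^m\times2^m$ matrices with $\gamma^\mu\gamma^\nu+\gamma^\nu\gamma^\mu=2\delta^{\mu\nu}$, let $\mathcal D$ be the selfadjoint Dirac operator on $\mathcal H$ with $\mathcal D(U_k\otimes v)=\sum_\mu k_\mu\,U_k\otimes\gamma^\mu v$, let $\epsilon\in\{1,-1\}$, and let $J=J_0\otimes C_0$,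 where $J_0(a)=a^*$ and $C_0$ is an antiunitary operator on $\mathbb C^{2^m}$ with $C_0^2=\pm1$ and $C_0\gamma^\mu=-\epsilon\gamma^\mu C_0$ for all $\mu$. Let $P_0$ be the orthogonal projection onto $\operatorname{Ker}\mathcal D$ and $D=\mathcal D+P_0$, which is invertible. For a bounded operator $T$ on $\mathcal H$, the noncommutative integral is $$⨍ T:=\operatorname{Res}_{s=0}\operatorname{Tr}\big(T|D|^{-s}\big),$$ where $\operatorname{Tr}(T|D|^{-s})$, defined for $\operatorname{Re}s$ large (where $T|D|^{-s}$ is trace class), is continued meromorphically to $\mathbb C$; the existence of this continuation is part of each of the assertions below. (i) Let $A_1,\dots,A_n\in\mathcal A$ be such that the one-form $A=\sum_\alpha L(-iA_\alpha)\otimes\gamma^\alpha$ is selfadjoint. Then, for all integers $p\ge0$ and $1\le q<n$, $$⨍ A^pD^{-q}=⨍(\epsilon JAJ^{-1})^pD^{-q}=0 .$$ In particular (case $p=q=1$), if $n>1$ then the vanishing tadpole condition $⨍ AD^{-1}=0$ holds; it holds for every one-form $A\in\Omega^1_{\mathcal D}(\mathcal A)=\{\sum_ia_i[\mathcal D,b_i]: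 a_i,b_i\in\mathcal A\}$. (ii) Suppose that $\frac1{2\pi}\Theta$ is Diophantine: there are $c,\delta>0$ such that $\big|\tfrac1{2\pi}\Theta q-m\big|\ge c\,|q|^{-\delta}$ for all $q\in\mathbb Z^n\setminus\{0\}$ and all $m\in\mathbb Z^n$ (Euclidean norms). Then $⨍ BD^{-q}=0$ for every integer $1\le q<n$ and every $B$ in the algebra generated by $\mathcal A$, $[\mathcal D,\mathcal A]$, $J\mathcal AJ^{-1}$ and $J[\mathcal D,\mathcal A]J^{-1}$. -/

import Mathlib

open scoped ComplexConjugate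

noncomputable section

namespace NCTorus

/-! ## Modes, Schwartz sequences, the Diophantine condition -/

/-- Frequencies `k ∈ ℤⁿ`. -/
abbrev Mode (n : ℕ) : Type := Fin n → ℤ

/-- The Euclidean norm of `k ∈ ℤⁿ`. -/
def modeNorm {n : ℕ} (k : Mode n) : ℝ := Real.sqrt (∑ i, (k i : ℝ) ^ 2)

theorem modeNorm_sq {n : ℕ} (k : Mode n) : modeNorm k ^ 2 = ∑ i, (k i : ℝ) ^ 2 :=
  Real.sq_sqrt (Finset.sum_nonneg fun _ _ => sq_nonneg _)

/-- Schwartz sequences on `ℤⁿ`: all the sequences `(1 + |k|²)^r |a_k|²` are bounded. -/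
def IsSchwartz {n : ℕ} (a : Mode n → ℂ) : Prop :=
  ∀ r : ℕ, ∃ C : ℝ, ∀ k, (1 + modeNorm k ^ 2) ^ r * ‖a k‖ ^ 2 ≤ C

/-- A real `n × n` matrix `M` is Diophantine if, for some `c, δ > 0`, the Euclidean distance of
`M q` to every `m ∈ ℤⁿ` is at least `c |q|^(-δ)`, for all nonzero `q ∈ ℤⁿ`. -/
def IsDiophantine {n : ℕ} (M : Matrix (Fin n) (Fin n) ℝ) : Prop :=
  ∃ δ : ℝ, 0 < δ ∧ ∃ c : ℝ, 0 < c ∧ ∀ q : Mode n, q ≠ 0 → ∀ m : Mode n,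
    c * modeNorm q ^ (-δ) ≤ Real.sqrt (∑ i, (M.mulVec (fun j => (q j : ℝ)) i - (m i : ℝ)) ^ 2)

/-- If the vector `a = ᵗM u` satisfies the scalar condition `|q . a - m| ≥ c |q|^(-δ)` for some
`u ∈ ℤⁿ`, then `M` is Diophantine. For a skew-symmetric `M` no such `u` exists, since `u . ᵗM u = 0`;
hence the condition on the distance to `ℤⁿ` above. -/
theorem isDiophantine_of_vector {n : ℕ} (M : Matrix (Fin n) (Fin n) ℝ) (u : Mode n)
    (h : ∃ δ : ℝ, 0 < δ ∧ ∃ c : ℝ, 0 < c ∧ ∀ q : Mode n, q ≠ 0 → ∀ m : ℤ,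
      c * modeNorm q ^ (-δ) ≤ |∑ i, (q i : ℝ) * M.transpose.mulVec (fun j => (u j : ℝ)) i - m|) :
    IsDiophantine M := by
  obtain ⟨δ, hδ, c, hc, h⟩ := h
  have hu : 0 ≤ modeNorm u := Real.sqrt_nonneg _
  refine ⟨δ, hδ, c / (modeNorm u + 1), by positivity, fun q hq m => ?_⟩
  have h1 := h q hq (∑ i, m i * u i)
  set w : Fin n → ℝ := fun i => M.mulVec (fun j => (q j : ℝ)) i - (m i : ℝ) with hw
  have e : (∑ i, (q i : ℝ) * M.transpose.mulVec (fun j => (u j : ℝ)) i - (∑ i, m i * u i : ℤ) : ℝ)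
      = ∑ i, w i * (u i : ℝ) := by
    have e1 : ∑ i, (q i : ℝ) * M.transpose.mulVec (fun j => (u j : ℝ)) i =
        ∑ i, M.mulVec (fun j => (q j : ℝ)) i * (u i : ℝ) := by
      simp only [Matrix.mulVec, dotProduct, Matrix.transpose_apply, Finset.mul_sum, Finset.sum_mul]
      rw [Finset.sum_comm]
      exact Finset.sum_congr rfl fun i _ => Finset.sum_congr rfl fun j _ => by ring
    rw [e1]
    push_cast
    rw [← Finset.sum_sub_distrib]
    exact Finset.sum_congr rfl fun i _ => by rw [hw]; ring
  rw [e] at h1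
  have h2 : |∑ i, w i * (u i : ℝ)| ≤ Real.sqrt (∑ i, w i ^ 2) * modeNorm u := by
    rw [modeNorm, ← Real.sqrt_mul (Finset.sum_nonneg fun _ _ => sq_nonneg _)]
    exact Real.abs_le_sqrt (Finset.sum_mul_sq_le_sq_mul_sq _ _ _)
  have h3 : 0 ≤ Real.sqrt (∑ i, w i ^ 2) := Real.sqrt_nonneg _
  rw [div_mul_eq_mul_div, div_le_iff₀ (by positivity)]
  nlinarith

/-- The pairing `k . Θ q`. -/
def pairing {n : ℕ} (Θ : Matrix (Fin n) (Fin n) ℝ) (k q : Mode n) : ℝ :=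
  ∑ i, ∑ j, (k i : ℝ) * Θ i j * (q j : ℝ)

/-! ## Spinors and Dirac matrices -/

/-- The space of spinors `ℂ^(2^m)`, `m = ⌊n / 2⌋`. -/
def Spinor (n : ℕ) : Type := EuclideanSpace ℂ (Fin (2 ^ (n / 2)))

instance (n : ℕ) : NormedAddCommGroup (Spinor n) :=
  inferInstanceAs (NormedAddCommGroup (EuclideanSpace ℂ (Fin (2 ^ (n / 2)))))

instance (n : ℕ) : InnerProductSpace ℂ (Spinor n) :=
  inferInstanceAs (InnerProductSpace ℂ (EuclideanSpace ℂ (Fin (2 ^ (n / 2)))))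

instance (n : ℕ) : FiniteDimensional ℂ (Spinor n) :=
  inferInstanceAs (FiniteDimensional ℂ (EuclideanSpace ℂ (Fin (2 ^ (n / 2)))))

instance (n : ℕ) : CompleteSpace (Spinor n) :=
  inferInstanceAs (CompleteSpace (EuclideanSpace ℂ (Fin (2 ^ (n / 2)))))

/-- The canonical orthonormal basis `(e_j)` of the spinors. -/
def spinorBasis (n : ℕ) : OrthonormalBasis (Fin (2 ^ (n / 2))) ℂ (Spinor n) :=
  EuclideanSpace.basisFun (Fin (2 ^ (n / 2))) ℂ

/-- Hermitian Dirac matrices on `ℂ^(2^m)`, and an antiunitary charge conjugation `C₀` with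
`C₀ γ^μ = -ε γ^μ C₀` and `C₀² = ± 1`. -/
structure SpinStructure (n : ℕ) where
  gamma : Fin n → (Spinor n →L[ℂ] Spinor n)
  gamma_selfAdjoint : ∀ μ, IsSelfAdjoint (gamma μ)
  clifford : ∀ μ ν, gamma μ * gamma ν + gamma ν * gamma μ = if μ = ν then 2 else 0
  eps : ℂ
  eps_eq : eps = 1 ∨ eps = -1
  C0 : Spinor n ≃ₛₗᵢ[starRingEnd ℂ] Spinor n
  C0_gamma : ∀ μ v, C0 (gamma μ v) = -(eps • gamma μ (C0 v))
  C0_sq : (∀ v, C0 (C0 v) = v) ∨ (∀ v, C0 (C0 v) = -v)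

/-! ## The Hilbert space and the operators acting on it -/

/-- The Hilbert space `H_τ ⊗ ℂ^(2^m)`. The GNS space `H_τ` has the orthonormal basis `(U_k)`, so
that a vector `∑ₖ U_k ⊗ ψ(k)` is the square summable family `ψ` of spinors. -/
abbrev Hil (n : ℕ) : Type := lp (fun _ : Mode n => Spinor n) 2

theorem memℓp_block {n : ℕ} {ρ : ℂ →+* ℂ} (σ : Mode n ≃ Mode n)
    (T : Mode n → Spinor n →SL[ρ] Spinor n) (C : ℝ) (hT : ∀ k v, ‖T k v‖ ≤ C * ‖v‖) (ψ : Hil n) :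
    Memℓp (fun k => T k (ψ (σ k))) 2 := by
  have h2 : (0 : ℝ) < (2 : ENNReal).toReal := by norm_num
  have h1 : Summable fun k => ‖ψ (σ k)‖ ^ (2 : ENNReal).toReal :=
    ((lp.memℓp ψ).summable h2).comp_injective σ.injective
  refine memℓp_gen (Summable.of_nonneg_of_le (fun k => by positivity) (fun k => ?_)
    (h1.mul_left (|C| ^ (2 : ENNReal).toReal)))
  rw [← Real.mul_rpow (abs_nonneg _) (norm_nonneg _)]
  refine Real.rpow_le_rpow (norm_nonneg _) ((hT k _).trans ?_) h2.le
  exact mul_le_mul_of_nonneg_right (le_abs_self C) (norm_nonneg _)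

/-- The bounded operator `ψ ↦ (k ↦ T_k ψ(σ k))` for a permutation `σ` of the modes and a
uniformly bounded family `T` of (linear or antilinear) maps of spinors. -/
def blockOp {n : ℕ} {ρ : ℂ →+* ℂ} (σ : Mode n ≃ Mode n)
    (T : Mode n → Spinor n →SL[ρ] Spinor n) (C : ℝ) (hT : ∀ k v, ‖T k v‖ ≤ C * ‖v‖) :
    Hil n →SL[ρ] Hil n :=
  LinearMap.mkContinuous
    { toFun := fun ψ => ⟨fun k => T k (ψ (σ k)), memℓp_block σ T C hT ψ⟩
      map_add' := fun ψ φ => by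
        ext1; funext k
        simp only [lp.coeFn_add, Pi.add_apply, map_add]
      map_smul' := fun c ψ => by
        ext1; funext k
        simp } |C| (fun ψ => by
    have h2 : (0 : ℝ) < (2 : ENNReal).toReal := by norm_num
    refine lp.norm_le_of_tsum_le h2 (by positivity) ?_
    have h1 := lp.hasSum_norm h2 ψ
    have h1c : HasSum (fun k => ‖ψ (σ k)‖ ^ (2 : ENNReal).toReal) (‖ψ‖ ^ (2 : ENNReal).toReal) :=
      (Equiv.hasSum_iff σ).mpr h1
    rw [Real.mul_rpow (abs_nonneg _) (norm_nonneg _)]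
    refine ((memℓp_block σ T C hT ψ).summable h2).tsum_le_of_sum_le (fun s => ?_) |>.trans le_rfl
    refine (Finset.sum_le_sum (fun k _ => ?_)).trans
      (((h1c.mul_left (|C| ^ (2 : ENNReal).toReal)).summable.sum_le_tsum s
        (fun k _ => by positivity)).trans (h1c.mul_left _).tsum_eq.le)
    rw [← Real.mul_rpow (abs_nonneg _) (norm_nonneg _)]
    refine Real.rpow_le_rpow (norm_nonneg _) ((hT k _).trans ?_) h2.le
    exact mul_le_mul_of_nonneg_right (le_abs_self C) (norm_nonneg _))

@[simp] theorem blockOp_apply {n : ℕ} {ρ : ℂ →+* ℂ} (σ : Mode n ≃ Mode n)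
    (T : Mode n → Spinor n →SL[ρ] Spinor n) (C : ℝ) (hT : ∀ k v, ‖T k v‖ ≤ C * ‖v‖)
    (ψ : Hil n) (k : Mode n) : blockOp σ T C hT ψ k = T k (ψ (σ k)) := rfl

theorem norm_blockOp_le {n : ℕ} (σ : Mode n ≃ Mode n)
    (T : Mode n → Spinor n →L[ℂ] Spinor n) (C : ℝ) (hT : ∀ k v, ‖T k v‖ ≤ C * ‖v‖) :
    ‖blockOp σ T C hT‖ ≤ |C| := by
  unfold blockOp
  exact LinearMap.mkContinuous_norm_le _ (abs_nonneg _) _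

/-- The operator `L(U_l) ⊗ M`: since `U_l U_r = e^(-(i/2) l.Θr) U_(l+r)`, it sends `U_r ⊗ v` to
`e^(-(i/2) l.Θr) U_(l+r) ⊗ M v`. -/
def weyl {n : ℕ} (Θ : Matrix (Fin n) (Fin n) ℝ) (l : Mode n) (M : Spinor n →L[ℂ] Spinor n) :
    Hil n →L[ℂ] Hil n :=
  blockOp (Equiv.subRight l)
    (fun k => Complex.exp (-(Complex.I / 2) * (pairing Θ l (k - l) : ℂ)) • M) ‖M‖ (fun k v => by
      have : ‖Complex.exp (-(Complex.I / 2) * (pairing Θ l (k - l) : ℂ))‖ = 1 := by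
        rw [Complex.norm_exp]; simp
      rw [smul_apply, norm_smul, this, one_mul]
      exact M.le_opNorm v)

/-- The Weyl relations `U_k U_q = e^(-(i/2) k.Θq) U_(k+q)`. -/
theorem weyl_mul_weyl {n : ℕ} (Θ : Matrix (Fin n) (Fin n) ℝ) (k q : Mode n)
    (M N : Spinor n →L[ℂ] Spinor n) :
    weyl Θ k M * weyl Θ q N =
      Complex.exp (-(Complex.I / 2) * (pairing Θ k q : ℂ)) • weyl Θ (k + q) (M * N) := by
  have hp : ∀ r, pairing Θ k (r - k) + pairing Θ q (r - k - q) =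
      pairing Θ k q + pairing Θ (k + q) (r - (k + q)) := fun r => by
    simp only [pairing, ← Finset.sum_add_distrib]
    refine Finset.sum_congr rfl fun i _ => Finset.sum_congr rfl fun j _ => ?_
    simp only [Pi.sub_apply, Pi.add_apply, Int.cast_sub, Int.cast_add]
    ring
  ext ψ : 1
  ext1; funext r
  simp only [weyl, mul_apply_eq_comp, smul_apply, lp.coeFn_smul, Pi.smul_apply,
    blockOp_apply, Equiv.subRight_apply, map_smul, smul_smul, ← Complex.exp_add, ← mul_add,
    ← Complex.ofReal_add]
  rw [add_comm (pairing Θ q _), hp r, sub_sub]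

/-- The operator `L(a) ⊗ M = ∑ₗ a_l L(U_l) ⊗ M`, where `a = ∑ₗ a_l U_l` is an element of the smooth
noncommutative torus. For a Schwartz sequence the series converges absolutely in operator norm. -/
def leftMul {n : ℕ} (Θ : Matrix (Fin n) (Fin n) ℝ) (a : Mode n → ℂ)
    (M : Spinor n →L[ℂ] Spinor n) : Hil n →L[ℂ] Hil n :=
  ∑' l, a l • weyl Θ l M

theorem norm_weyl_le {n : ℕ} (Θ : Matrix (Fin n) (Fin n) ℝ) (l : Mode n)
    (M : Spinor n →L[ℂ] Spinor n) : ‖weyl Θ l M‖ ≤ ‖M‖ :=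
  (norm_blockOp_le _ _ _ _).trans (abs_norm M).le

theorem IsSchwartz.summable_norm {n : ℕ} {a : Mode n → ℂ} (ha : IsSchwartz a) :
    Summable fun l => ‖a l‖ := by
  obtain ⟨C, hC⟩ := ha (2 * n)
  have hs1 : Summable fun m : ℤ => (1 + (m : ℝ) ^ 2)⁻¹ := by
    have h0 : Summable fun m : ℤ => 1 / (m : ℝ) ^ 2 :=
      Real.summable_one_div_int_pow.mpr (by norm_num)
    refine Summable.of_norm_bounded_eventually h0 ?_
    rw [Filter.eventually_cofinite]
    refine (Set.finite_singleton (0 : ℤ)).subset fun m hm => ?_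
    by_contra hne
    have hne0 : (m : ℝ) ≠ 0 := by exact_mod_cast hne
    have hm2 : (0 : ℝ) < (m : ℝ) ^ 2 := by positivity
    refine hm ?_
    rw [Real.norm_of_nonneg (by positivity), one_div]
    exact inv_anti₀ hm2 (by linarith)
  have hs : Summable fun l : Mode n => ∏ i, (1 + (l i : ℝ) ^ 2)⁻¹ := by
    refine summable_of_sum_le (c := ∏ _i : Fin n, ∑' m : ℤ, (1 + (m : ℝ) ^ 2)⁻¹)
      (fun l => Finset.prod_nonneg fun i _ => by positivity) fun u => ?_
    classical
    have hu : u ⊆ Fintype.piFinset fun i => u.image fun l => l i := fun l hl => by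
      rw [Fintype.mem_piFinset]
      exact fun i => Finset.mem_image_of_mem _ hl
    refine (Finset.sum_le_sum_of_subset_of_nonneg hu
      fun l _ _ => Finset.prod_nonneg fun i _ => by positivity).trans ?_
    rw [← Finset.prod_univ_sum (fun i => u.image fun l => l i)
      (fun (_ : Fin n) (m : ℤ) => (1 + (m : ℝ) ^ 2)⁻¹)]
    exact Finset.prod_le_prod (fun i _ => Finset.sum_nonneg fun m _ => by positivity)
      fun i _ => hs1.sum_le_tsum _ fun m _ => by positivity
  refine Summable.of_nonneg_of_le (fun _ => norm_nonneg _) (fun l => ?_) (hs.mul_left (Real.sqrt C))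
  have hpos : 0 < ∏ i, (1 + (l i : ℝ) ^ 2) := Finset.prod_pos fun i _ => by positivity
  have hle : ∏ i, (1 + (l i : ℝ) ^ 2) ≤ (1 + modeNorm l ^ 2) ^ n := by
    have := Finset.prod_le_prod (s := Finset.univ) (f := fun i => 1 + (l i : ℝ) ^ 2)
      (g := fun _ : Fin n => 1 + modeNorm l ^ 2) (fun i _ => by positivity) fun i _ => by
        rw [modeNorm_sq]
        have := Finset.single_le_sum (f := fun i => (l i : ℝ) ^ 2)
          (fun _ _ => sq_nonneg _) (Finset.mem_univ i)
        simpa using this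
    simpa using this
  rw [Finset.prod_inv_distrib, ← div_eq_mul_inv, le_div_iff₀ hpos]
  refine Real.le_sqrt_of_sq_le (le_trans ?_ (hC l))
  rw [mul_pow, mul_comm, pow_mul', ]
  gcongr

/-- The series that defines `L(a) ⊗ M` converges absolutely. -/
theorem IsSchwartz.summable_leftMul {n : ℕ} (Θ : Matrix (Fin n) (Fin n) ℝ) {a : Mode n → ℂ}
    (ha : IsSchwartz a) (M : Spinor n →L[ℂ] Spinor n) :
    Summable fun l => ‖a l • weyl Θ l M‖ :=
  Summable.of_nonneg_of_le (fun _ => norm_nonneg _)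
    (fun l => (norm_smul_le _ _).trans
      (mul_le_mul_of_nonneg_left (norm_weyl_le Θ l M) (norm_nonneg _)))
    (ha.summable_norm.mul_right ‖M‖)

/-- The algebra `𝒜` of the smooth noncommutative torus, represented on the Hilbert space as
`L(a) ⊗ 1`. -/
def torusAlg (n : ℕ) (Θ : Matrix (Fin n) (Fin n) ℝ) : Set (Hil n →L[ℂ] Hil n) :=
  {T | ∃ a : Mode n → ℂ, IsSchwartz a ∧ T = leftMul Θ a 1}

/-- Clifford multiplication `k_μ γ^μ`. -/
def slash {n : ℕ} (S : SpinStructure n) (k : Mode n) : Spinor n →L[ℂ] Spinor n :=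
  ∑ μ, (k μ : ℂ) • S.gamma μ

/-- The selfadjoint Dirac operator `𝒟 = -i δ_μ ⊗ γ^μ`, that is `𝒟 (U_k ⊗ v) = U_k ⊗ k_μ γ^μ v`, on
its maximal domain. -/
def dirac {n : ℕ} (S : SpinStructure n) : Hil n →ₗ.[ℂ] Hil n where
  domain :=
    { carrier := {ψ | Memℓp (fun k => slash S k (ψ k)) 2}
      add_mem' := fun {ψ φ} hψ hφ => by
        have := Memℓp.add hψ hφ
        refine (congrArg (fun f => Memℓp f 2) ?_).mp this
        funext k; simp
      zero_mem' := by
        refine (congrArg (fun f => Memℓp f 2) ?_).mp (zero_memℓp (E := fun _ : Mode n => Spinor n))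
        funext k; simp
      smul_mem' := fun c ψ hψ => by
        have := Memℓp.const_smul hψ c
        refine (congrArg (fun f => Memℓp f 2) ?_).mp this
        funext k; simp }
  toFun :=
    { toFun := fun ψ => ⟨fun k => slash S k ((ψ : Hil n) k), ψ.2⟩
      map_add' := fun ψ φ => by
        ext1; funext k
        simp only [Submodule.coe_add, lp.coeFn_add, Pi.add_apply, map_add]
      map_smul' := fun c ψ => by
        ext1; funext k; simp }

/-- `C` is the commutator `[D, T]` of an unbounded operator `D` with a bounded operator `T`: on the
domain of `D`, which `T` preserves, `D T - T D = C`. -/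
def IsCommutator {n : ℕ} (D : Hil n →ₗ.[ℂ] Hil n) (T C : Hil n →L[ℂ] Hil n) : Prop :=
  ∀ ψ : D.domain, ∃ h : T (ψ : Hil n) ∈ D.domain, D ⟨T (ψ : Hil n), h⟩ - T (D ψ) = C (ψ : Hil n)

/-- The set `[𝒟, 𝒜]`. -/
def diracComm {n : ℕ} (Θ : Matrix (Fin n) (Fin n) ℝ) (S : SpinStructure n) :
    Set (Hil n →L[ℂ] Hil n) :=
  {C | ∃ T ∈ torusAlg n Θ, IsCommutator (dirac S) T C}

/-- The space `Ω¹ = {∑ᵢ aᵢ [𝒟, bᵢ]}` of one-forms. -/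
def oneForms {n : ℕ} (Θ : Matrix (Fin n) (Fin n) ℝ) (S : SpinStructure n) :
    Submodule ℂ (Hil n →L[ℂ] Hil n) :=
  Submodule.span ℂ {X | ∃ T ∈ torusAlg n Θ, ∃ C ∈ diracComm Θ S, X = T * C}

/-- The one-form `L(-i A_α) ⊗ γ^α = -i ∑ₗ a_(α,l) U_l ⊗ γ^α`, where `A_α = ∑ₗ a_(α,l) U_l`. -/
def oneForm {n : ℕ} (Θ : Matrix (Fin n) (Fin n) ℝ) (S : SpinStructure n)
    (a : Fin n → Mode n → ℂ) : Hil n →L[ℂ] Hil n :=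
  ∑ α, (-Complex.I) • leftMul Θ (a α) (S.gamma α)

/-- The reality operator `J = J₀ ⊗ C₀`, where `J₀ (∑ₖ c_k U_k) = ∑ₖ conj c_k U_(-k)` is the Tomita
conjugation `J₀(a) = a^*`. -/
def realJ {n : ℕ} (S : SpinStructure n) : Hil n →SL[starRingEnd ℂ] Hil n :=
  blockOp (Equiv.neg _) (fun _ => S.C0.toContinuousLinearEquiv.toContinuousLinearMap) 1
    (fun _ v => by simp)

/-- The inverse of `J`. -/
def realJInv {n : ℕ} (S : SpinStructure n) : Hil n →SL[starRingEnd ℂ] Hil n :=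
  blockOp (Equiv.neg _) (fun _ => S.C0.symm.toContinuousLinearEquiv.toContinuousLinearMap) 1
    (fun _ v => by simp)

theorem realJ_realJInv {n : ℕ} (S : SpinStructure n) (ψ : Hil n) :
    realJ S (realJInv S ψ) = ψ ∧ realJInv S (realJ S ψ) = ψ := by
  constructor <;> (ext1; funext k; simp [realJ, realJInv])

/-- `J T J⁻¹`. -/
def conjJ {n : ℕ} (S : SpinStructure n) (T : Hil n →L[ℂ] Hil n) : Hil n →L[ℂ] Hil n :=
  (realJ S).comp (T.comp (realJInv S))

/-- The algebra generated by `𝒜`, `[𝒟, 𝒜]`, `J 𝒜 J⁻¹` and `J [𝒟, 𝒜] J⁻¹`. -/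
def bigAlg {n : ℕ} (Θ : Matrix (Fin n) (Fin n) ℝ) (S : SpinStructure n) :
    Subalgebra ℂ (Hil n →L[ℂ] Hil n) :=
  Algebra.adjoin ℂ (torusAlg n Θ ∪ diracComm Θ S ∪ conjJ S '' torusAlg n Θ ∪
    conjJ S '' diracComm Θ S)

/-! ## The invertible operator `D = 𝒟 + P₀` and its powers -/

/-- The operator `P₀`, which is the orthogonal projection onto `Ker 𝒟 = U_0 ⊗ ℂ^(2^m)`. -/
def kerProj (n : ℕ) : Hil n →L[ℂ] Hil n :=
  blockOp (Equiv.refl _) (fun k => if k = 0 then 1 else 0) 1 (fun k v => by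
    split_ifs <;> simp)

theorem one_le_modeNorm {n : ℕ} {k : Mode n} (hk : k ≠ 0) : 1 ≤ modeNorm k := by
  obtain ⟨i, hi⟩ := Function.ne_iff.mp hk
  rw [modeNorm, Real.one_le_sqrt]
  have h1 : (1 : ℝ) ≤ (k i : ℝ) ^ 2 := by
    have : (1 : ℤ) ≤ (k i) ^ 2 := by
      have := sq_pos_of_ne_zero (show k i ≠ 0 from hi)
      omega
    exact_mod_cast this
  exact h1.trans (Finset.single_le_sum (f := fun i => (k i : ℝ) ^ 2)
    (fun _ _ => sq_nonneg _) (Finset.mem_univ i))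

theorem abs_le_modeNorm {n : ℕ} (k : Mode n) (i : Fin n) : |(k i : ℝ)| ≤ modeNorm k := by
  rw [← Real.sqrt_sq_eq_abs]
  exact Real.sqrt_le_sqrt (Finset.single_le_sum (f := fun i => (k i : ℝ) ^ 2)
    (fun _ _ => sq_nonneg _) (Finset.mem_univ i))

theorem slash_sq {n : ℕ} (S : SpinStructure n) (k : Mode n) :
    slash S k * slash S k = ((modeNorm k ^ 2 : ℝ) : ℂ) • 1 := by
  have key : (2 : ℂ) • (slash S k * slash S k) = (2 : ℂ) • (((modeNorm k ^ 2 : ℝ) : ℂ) • 1) := by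
    have e1 : slash S k * slash S k =
        ∑ μ, ∑ ν, ((k μ : ℂ) * (k ν : ℂ)) • (S.gamma μ * S.gamma ν) := by
      simp only [slash, Finset.sum_mul, Finset.mul_sum, smul_mul_smul_comm]
      exact Finset.sum_comm
    have e2 : slash S k * slash S k =
        ∑ μ, ∑ ν, ((k μ : ℂ) * (k ν : ℂ)) • (S.gamma ν * S.gamma μ) := by
      rw [e1, Finset.sum_comm]
      simp only [mul_comm]
    rw [two_smul]
    nth_rewrite 1 [e1]
    rw [e2]
    simp only [← Finset.sum_add_distrib, ← smul_add, S.clifford]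
    rw [modeNorm_sq]
    simp only [smul_ite, smul_zero, Finset.sum_ite_eq, Finset.mem_univ, if_true]
    push_cast
    rw [Finset.sum_smul, Finset.smul_sum]
    refine Finset.sum_congr rfl fun μ _ => ?_
    rw [← sq, smul_comm, two_smul, one_add_one_eq_two]
  exact smul_right_injective _ (two_ne_zero) key

/-- The symbol `k_μ γ^μ / |k|²` of `D⁻¹` on `U_k ⊗ ℂ^(2^m)` for `k ≠ 0`; the symbol at `0` is `1`. -/
def diracInvSymbol {n : ℕ} (S : SpinStructure n) (k : Mode n) : Spinor n →L[ℂ] Spinor n :=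
  if k = 0 then 1 else (((modeNorm k ^ 2)⁻¹ : ℝ) : ℂ) • slash S k

theorem diracInvSymbol_bound {n : ℕ} (S : SpinStructure n) (k : Mode n) (v : Spinor n) :
    ‖diracInvSymbol S k v‖ ≤ (1 + ∑ μ, ‖S.gamma μ‖) * ‖v‖ := by
  have h0 : 0 ≤ ∑ μ, ‖S.gamma μ‖ := Finset.sum_nonneg fun _ _ => norm_nonneg _
  unfold diracInvSymbol
  split_ifs with hk
  · simp only [one_apply_eq_self]
    nlinarith [norm_nonneg v]
  · have h1 := one_le_modeNorm hk
    have h2 : ‖slash S k‖ ≤ modeNorm k * ∑ μ, ‖S.gamma μ‖ := by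
      rw [slash, Finset.mul_sum]
      refine norm_sum_le_of_le _ fun μ _ => ?_
      rw [norm_smul]
      refine mul_le_mul_of_nonneg_right ?_ (norm_nonneg _)
      simpa using abs_le_modeNorm k μ
    have h3 : ‖slash S k v‖ ≤ modeNorm k * (∑ μ, ‖S.gamma μ‖) * ‖v‖ :=
      (ContinuousLinearMap.le_opNorm _ v).trans (mul_le_mul_of_nonneg_right h2 (norm_nonneg _))
    rw [smul_apply, norm_smul, Complex.norm_real, Real.norm_eq_abs,
      abs_of_nonneg (by positivity), inv_mul_le_iff₀ (by positivity)]
    refine h3.trans ?_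
    have h4 : modeNorm k ≤ modeNorm k ^ 2 := by nlinarith
    calc modeNorm k * (∑ μ, ‖S.gamma μ‖) * ‖v‖
        = modeNorm k * ((∑ μ, ‖S.gamma μ‖) * ‖v‖) := by ring
      _ ≤ modeNorm k ^ 2 * ((1 + ∑ μ, ‖S.gamma μ‖) * ‖v‖) := by
          refine mul_le_mul h4 ?_ (by positivity) (by positivity)
          nlinarith [norm_nonneg v]

/-- The bounded operator `D⁻¹`, where `D = 𝒟 + P₀`. -/
def diracInv {n : ℕ} (S : SpinStructure n) : Hil n →L[ℂ] Hil n :=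
  blockOp (Equiv.refl _) (diracInvSymbol S) _ (diracInvSymbol_bound S)

theorem slash_zero {n : ℕ} (S : SpinStructure n) : slash S 0 = 0 := by simp [slash]

theorem slash_slash_apply {n : ℕ} (S : SpinStructure n) (k : Mode n) (v : Spinor n) :
    slash S k (slash S k v) = ((modeNorm k ^ 2 : ℝ) : ℂ) • v := by
  have := congrArg (fun T : Spinor n →L[ℂ] Spinor n => T v) (slash_sq S k)
  simpa using this

theorem symbol_left {n : ℕ} (S : SpinStructure n) (k : Mode n) (v : Spinor n) :
    slash S k (diracInvSymbol S k v) + (if k = 0 then diracInvSymbol S k v else 0) = v := by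
  unfold diracInvSymbol
  split_ifs with hk
  · subst hk; simp [slash_zero]
  · have h1 := one_le_modeNorm hk
    have h2 : (((modeNorm k ^ 2)⁻¹ : ℝ) : ℂ) * ((modeNorm k ^ 2 : ℝ) : ℂ) = 1 := by
      rw [← Complex.ofReal_mul, inv_mul_cancel₀ (by positivity), Complex.ofReal_one]
    rw [smul_apply, map_smul, slash_slash_apply, smul_smul, h2, one_smul,
      add_zero]

/-- The kernel of `𝒟` is the range of `P₀`. -/
theorem dirac_eq_zero_iff {n : ℕ} (S : SpinStructure n) (ψ : (dirac S).domain) :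
    dirac S ψ = 0 ↔ kerProj n (ψ : Hil n) = (ψ : Hil n) := by
  constructor
  · intro h
    ext1; funext k
    have hk : slash S k ((ψ : Hil n) k) = 0 := congrArg (fun φ : Hil n => φ k) h
    by_cases h0 : k = 0
    · simp [kerProj, h0]
    · have h1 := one_le_modeNorm h0
      have h2 := slash_slash_apply S k ((ψ : Hil n) k)
      rw [hk, map_zero, eq_comm, smul_eq_zero] at h2
      rcases h2 with h2 | h2
      · have : modeNorm k ^ 2 = 0 := by exact_mod_cast h2
        nlinarith
      · simp [kerProj, h0, h2]
  · intro h
    ext1; funext k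
    change slash S k ((ψ : Hil n) k) = 0
    by_cases h0 : k = 0
    · simp [h0, slash_zero]
    · have := congrArg (fun φ : Hil n => φ k) h
      simp [kerProj, h0] at this
      rw [← this, map_zero]

/-- `diracInv` is the two-sided inverse of `D = 𝒟 + P₀`. -/
theorem diracInv_spec {n : ℕ} (S : SpinStructure n) :
    (∀ ψ : Hil n, ∃ h : diracInv S ψ ∈ (dirac S).domain,
      dirac S ⟨diracInv S ψ, h⟩ + kerProj n (diracInv S ψ) = ψ) ∧
    ∀ ψ : (dirac S).domain, diracInv S (dirac S ψ + kerProj n (ψ : Hil n)) = (ψ : Hil n) := by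
  constructor
  · intro ψ
    have e : (fun k => slash S k (diracInv S ψ k)) = fun k => (ψ - kerProj n (diracInv S ψ)) k := by
      funext k
      have h := symbol_left S k (ψ k)
      rw [lp.coeFn_sub, Pi.sub_apply, eq_sub_iff_add_eq]
      refine Eq.trans ?_ h
      congr 1
      simp only [kerProj, diracInv, blockOp_apply, Equiv.refl_apply]
      split_ifs <;> simp
    have h : diracInv S ψ ∈ (dirac S).domain := by
      change Memℓp (fun k => slash S k (diracInv S ψ k)) 2
      rw [e]
      exact lp.memℓp _
    refine ⟨h, ?_⟩
    ext1; funext k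
    have := congrFun e k
    rw [lp.coeFn_sub, Pi.sub_apply, eq_sub_iff_add_eq] at this
    exact this
  · intro ψ
    ext1; funext k
    change diracInvSymbol S k (slash S k ((ψ : Hil n) k) + kerProj n (ψ : Hil n) k) = _
    by_cases hk : k = 0
    · subst hk; simp [diracInvSymbol, kerProj, slash_zero]
    · have h := symbol_left S k ((ψ : Hil n) k)
      simp [diracInvSymbol, hk] at h
      simp [diracInvSymbol, kerProj, hk, h]

/-- The bounded operator `|D|^(-s)`, for `Re s ≥ 0`: as `D² = |k|²` on `U_k ⊗ ℂ^(2^m)` for `k ≠ 0`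
and `D² = 1` for `k = 0`, it is `|k|^(-s)` for `k ≠ 0` and `1` for `k = 0`. -/
def absDiracPow (n : ℕ) (s : ℂ) (hs : 0 ≤ s.re) : Hil n →L[ℂ] Hil n :=
  blockOp (Equiv.refl _)
    (fun k => (if k = 0 then (1 : ℂ) else (modeNorm k : ℂ) ^ (-s)) • (1 : Spinor n →L[ℂ] Spinor n))
    1 (fun k v => by
      rw [smul_apply, norm_smul, one_apply_eq_self]
      refine mul_le_mul_of_nonneg_right ?_ (norm_nonneg _)
      split_ifs with hk
      · simp
      · have h1 := one_le_modeNorm hk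
        rw [Complex.norm_cpow_eq_rpow_re_of_pos (by linarith)]
        exact Real.rpow_le_one_of_one_le_of_nonpos h1 (by simpa using hs))

theorem absDiracPow_two {n : ℕ} (S : SpinStructure n) (hs : 0 ≤ (2 : ℂ).re) :
    absDiracPow n 2 hs = diracInv S * diracInv S := by
  ext ψ : 1
  ext1; funext k
  simp only [absDiracPow, diracInv, mul_apply_eq_comp, blockOp_apply,
    Equiv.refl_apply, diracInvSymbol, smul_apply, one_apply_eq_self]
  split_ifs with hk
  · simp
  · have h1 : (modeNorm k : ℂ) ≠ 0 := by
      have := one_le_modeNorm hk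
      exact_mod_cast (by linarith : modeNorm k ≠ 0)
    rw [smul_apply, smul_apply, map_smul, slash_slash_apply, smul_smul, smul_smul, Complex.cpow_neg]
    congr 1
    have : (modeNorm k : ℂ) ^ (2 : ℂ) = (modeNorm k : ℂ) ^ (2 : ℕ) := by
      rw [← Complex.cpow_natCast]; norm_num
    rw [this]
    push_cast
    field_simp

theorem absDiracPow_add (n : ℕ) (s t : ℂ) (hs : 0 ≤ s.re) (ht : 0 ≤ t.re)
    (hst : 0 ≤ (s + t).re) :
    absDiracPow n (s + t) hst = absDiracPow n s hs * absDiracPow n t ht := by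
  ext ψ : 1
  ext1; funext k
  simp only [absDiracPow, mul_apply_eq_comp, blockOp_apply, Equiv.refl_apply,
    smul_apply, one_apply_eq_self, smul_smul]
  split_ifs with hk
  · simp
  · have h1 : (modeNorm k : ℂ) ≠ 0 := by
      have := one_le_modeNorm hk
      exact_mod_cast (by linarith : modeNorm k ≠ 0)
    rw [neg_add, Complex.cpow_add _ _ h1]

/-! ## The noncommutative integral -/

/-- The basis vector `U_k ⊗ e_j`. -/
def basisVec {n : ℕ} (p : Mode n × Fin (2 ^ (n / 2))) : Hil n :=
  lp.single 2 p.1 (spinorBasis n p.2)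

/-- Trace class operators, as the operators `∑ᵢ ⟨yᵢ, ·⟩ xᵢ` with `∑ᵢ ‖xᵢ‖ ‖yᵢ‖ < ∞`. -/
def IsTraceClass {n : ℕ} (T : Hil n →L[ℂ] Hil n) : Prop :=
  ∃ (ι : Type) (x y : ι → Hil n), Summable (fun i => ‖x i‖ * ‖y i‖) ∧
    ∀ ψ, HasSum (fun i => (inner ℂ (y i) ψ) • x i) (T ψ)

/-- The trace, `Tr T = ∑ ⟨U_k ⊗ e_j, T (U_k ⊗ e_j)⟩`. -/
def opTrace {n : ℕ} (T : Hil n →L[ℂ] Hil n) : ℂ :=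
  ∑' p : Mode n × Fin (2 ^ (n / 2)), inner ℂ (basisVec p) (T (basisVec p))

/-- `c` is the residue of `f` at `z₀`: the integral `(2πi)⁻¹ ∮ f` over all small circles around
`z₀` is `c`. -/
def HasResidue (f : ℂ → ℂ) (z₀ c : ℂ) : Prop :=
  ∀ᶠ r : ℝ in nhdsWithin 0 (Set.Ioi 0),
    (2 * Real.pi * Complex.I)⁻¹ * (∮ z in C(z₀, r), f z) = c

/-- The noncommutative integral of the bounded operator `T` exists and is `c`: for `Re s` large
enough, `T |D|^(-s)` is trace class, the function `s ↦ Tr (T |D|^(-s))` extends meromorphically to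
the complex plane, and the residue of the extension at `s = 0` is `c`. -/
def HasNCIntegral {n : ℕ} (T : Hil n →L[ℂ] Hil n) (c : ℂ) : Prop :=
  ∃ (F : ℂ → ℂ) (R : ℝ) (hR : 0 ≤ R), Meromorphic F ∧
    (∀ (s : ℂ) (hs : R < s.re),
      IsTraceClass (T * absDiracPow n s (hR.trans hs.le)) ∧
        opTrace (T * absDiracPow n s (hR.trans hs.le)) = F s) ∧
    HasResidue F 0 c

end NCTorus

end

open NCTorus

noncomputable section

namespace NCTorus

/-! ## Difference operators applied to powers of the norm -/

/-! Everything reduces to lattice zeta series with weights. The operators `|D|^(-s)` and `D^(-q)`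
are block diagonal in the modes, so the trace of `T D^(-q) |D|^(-s)` only sees the diagonal blocks
of `T`. For even `q` the symbol of `D^(-q)` is `|k|^(-q)`; for odd `q` it is `∑ k_μ γ^μ |k|^(-q-1)`.
Apart from the mode `0`, the trace is therefore a finite sum of series `∑ w(k) k_μ^d |k|^(-s')`,
with `(d, s') = (0, s + q)` or `(1, s + q + 1)`, where `w` is a partial trace over spinors of the
diagonal blocks of `T` (`opTrace_eq_tsum`).

All the operators `T` of the theorem are rapidly convergent series of products of left and right
multiplications, with frequencies `(l, m)`; these form an algebra (`smoothAlg`), and conjugation by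
`J` exchanges left and right. A term reaches the diagonal only if `m = -l`, and then contributes the
character `e^(-i l.Θk)`. Thus `w` is a constant plus a series of characters with `l ≠ 0`. With left
multiplications alone, or right ones alone, `m = -l` forces `l = 0` and the weight is constant,
whence (i) for arbitrary `Θ`. In (ii) the Diophantine condition bounds the small divisors `e^(-i
l.Θe_j) - 1` from below by a power of `1 + ‖l‖`, which the rapid decay of the coefficients absorbs
(`exists_isDiffExact_diagWeight`).

A series of nontrivial characters with such divisors is, for every `N`, a sum of `N`-th differences
of bounded functions (`IsDiffExact`). Summation by parts moves the differences to `k_μ^d |k|^(-s)`,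
where Cauchy estimates gain the factor `|k|^(-N)`; as `N` is arbitrary, the zeta series is entire
(`IsDiffExact.exists_entire`).

For the constant weight, compare the sum over `ℤⁿ` with the sum over `2ℤⁿ`. By homogeneity, `2^n`
times the latter is `2^(n+d-s)` times the full series. But `2^n` times the indicator of `2ℤⁿ` is `1`
plus nontrivial characters of order two, which are difference-exact. Hence `2^(n+d-s) - 1` times the
series is entire, and its continuation can have poles only on the line `Re s = n + d`
(`exists_meromorphic_extension`). In the trace this line becomes `Re s = n - q`, for both parities.
It misses the origin when `q < n`, so that the continuation is analytic there and the residue is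
zero. -/

theorem modeNorm_nonneg {n : ℕ} (k : Mode n) : 0 ≤ modeNorm k := Real.sqrt_nonneg _

theorem modeNorm_pos {n : ℕ} {k : Mode n} (hk : k ≠ 0) : 0 < modeNorm k :=
  zero_lt_one.trans_le (one_le_modeNorm hk)

theorem summable_prod_one_add_sq_inv (n : ℕ) :
    Summable fun l : Mode n => ∏ i, (1 + (l i : ℝ) ^ 2)⁻¹ := by
  have hs1 : Summable fun m : ℤ => (1 + (m : ℝ) ^ 2)⁻¹ := by
    have h0 : Summable fun m : ℤ => 1 / (m : ℝ) ^ 2 :=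
      Real.summable_one_div_int_pow.mpr (by norm_num)
    refine Summable.of_norm_bounded_eventually h0 ?_
    rw [Filter.eventually_cofinite]
    refine (Set.finite_singleton (0 : ℤ)).subset fun m hm => ?_
    by_contra hne
    have hne0 : (m : ℝ) ≠ 0 := by exact_mod_cast hne
    have hm2 : (0 : ℝ) < (m : ℝ) ^ 2 := by positivity
    refine hm ?_
    rw [Real.norm_of_nonneg (by positivity), one_div]
    exact inv_anti₀ hm2 (by linarith)
  refine summable_of_sum_le (c := ∏ _i : Fin n, ∑' m : ℤ, (1 + (m : ℝ) ^ 2)⁻¹)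
    (fun l => Finset.prod_nonneg fun i _ => by positivity) fun u => ?_
  classical
  have hu : u ⊆ Fintype.piFinset fun i => u.image fun l => l i := fun l hl => by
    rw [Fintype.mem_piFinset]
    exact fun i => Finset.mem_image_of_mem _ hl
  refine (Finset.sum_le_sum_of_subset_of_nonneg hu
    fun l _ _ => Finset.prod_nonneg fun i _ => by positivity).trans ?_
  rw [← Finset.prod_univ_sum (fun i => u.image fun l => l i)
    (fun (_ : Fin n) (m : ℤ) => (1 + (m : ℝ) ^ 2)⁻¹)]
  exact Finset.prod_le_prod (fun i _ => Finset.sum_nonneg fun m _ => by positivity)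
    fun i _ => hs1.sum_le_tsum _ fun m _ => by positivity

/-- Comparison with a product of `n` one-dimensional series costs two powers of the norm per
coordinate. The sharp threshold `-n` is not needed: the series only have to converge on some right
half-plane. -/
theorem summable_modeNorm_rpow {n : ℕ} {r : ℝ} (hr : r ≤ -(2 * n : ℝ)) :
    Summable fun k : Mode n => modeNorm k ^ r := by
  refine Summable.of_norm_bounded_eventually ((summable_prod_one_add_sq_inv n).mul_left (2 ^ n)) ?_
  rw [Filter.eventually_cofinite]
  refine (Set.finite_singleton (0 : Mode n)).subset fun k hk => ?_
  by_contra h0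
  have h0 : k ≠ 0 := h0
  refine hk ?_
  have h1 := one_le_modeNorm h0
  rw [Real.norm_of_nonneg (by positivity)]
  have h2 : modeNorm k ^ r ≤ modeNorm k ^ (-(2 * n : ℝ)) := Real.rpow_le_rpow_of_exponent_le h1 hr
  refine h2.trans ?_
  rw [Real.rpow_neg (by positivity), Finset.prod_inv_distrib]
  have h3 : modeNorm k ^ (2 * n : ℝ) = (modeNorm k ^ 2) ^ n := by
    rw [← pow_mul]; exact_mod_cast Real.rpow_natCast _ (2 * n)
  rw [h3, ← div_eq_mul_inv, le_div_iff₀ (Finset.prod_pos fun i _ => by positivity),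
    inv_mul_le_iff₀ (by positivity), ← mul_pow]
  calc ∏ i, (1 + (k i : ℝ) ^ 2) ≤ ∏ _i : Fin n, (modeNorm k ^ 2 * 2) := by
        refine Finset.prod_le_prod (fun i _ => by positivity) fun i _ => ?_
        have : (k i : ℝ) ^ 2 ≤ modeNorm k ^ 2 := by
          rw [← sq_abs]; exact pow_le_pow_left₀ (abs_nonneg _) (abs_le_modeNorm k i) 2
        nlinarith
    _ = _ := by simp

theorem finite_modeNorm_lt (n : ℕ) (K : ℝ) : {k : Mode n | modeNorm k < K}.Finite := by
  refine (Set.finite_Icc (fun _ => -⌈K⌉ : Mode n) (fun _ => ⌈K⌉)).subset fun k hk => ?_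
  have h : ∀ i, |k i| ≤ ⌈K⌉ := fun i => by
    have h1 : ((|k i| : ℤ) : ℝ) < K := by
      push_cast; exact (abs_le_modeNorm k i).trans_lt hk
    exact_mod_cast (h1.le.trans (Int.le_ceil K))
  exact ⟨fun i => (abs_le.mp (h i)).1, fun i => (abs_le.mp (h i)).2⟩

/-- Cauchy estimates for the iterated difference of a bounded holomorphic function. -/
theorem norm_fwdDiff_iter_le {ρ A : ℝ} (hρ : 0 < ρ) (N : ℕ) : ∀ {R : ℝ} {h : ℂ → ℂ} (_ : 0 ≤ A),
    DifferentiableOn ℂ h (Metric.ball 0 R) → (∀ z ∈ Metric.ball (0 : ℂ) R, ‖h z‖ ≤ A) →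
    ∀ z ∈ Metric.ball (0 : ℂ) (R - N * (ρ + 1)), ‖(fwdDiff (-1 : ℂ))^[N] h z‖ ≤ A / ρ ^ N := by
  induction N generalizing A with
  | zero => intro R h _ _ hb z hz; simpa using hb z (by simpa using hz)
  | succ N ih =>
    intro R h hA hd hb z hz
    rw [Function.iterate_succ_apply]
    -- Each difference shrinks the radius by `ρ` for the Cauchy estimate of the derivative and by
    -- `1` for the translation, and gains a factor `1 / ρ`.
    have key := ih (A := A / ρ) (R := R - (ρ + 1)) (h := fwdDiff (-1 : ℂ) h) (by positivity) ?_ ?_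
      z ?_
    · rwa [div_div, ← pow_succ'] at key
    · refine DifferentiableOn.sub ?_ ?_
      · refine hd.comp (by fun_prop) fun z hz => ?_
        simp only [mem_ball_zero_iff] at hz ⊢
        have : ‖z + -1‖ ≤ ‖z‖ + ‖(-1 : ℂ)‖ := norm_add_le _ _
        simp only [norm_neg, norm_one] at this
        linarith
      · refine hd.mono (Metric.ball_subset_ball (by linarith))
    · intro z hz
      have hz1 : ‖z‖ < R - (ρ + 1) := by simpa using hz
      have hsub : ∀ w ∈ Metric.ball (0 : ℂ) (R - ρ), ‖deriv h w‖ ≤ A / ρ := by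
        intro w hw
        have hcb : Metric.closedBall w ρ ⊆ Metric.ball 0 R := by
          intro y hy
          have h1 : ‖w‖ < R - ρ := by simpa using hw
          have h2 : ‖y - w‖ ≤ ρ := by simpa [dist_eq_norm] using hy
          have h3 : ‖y‖ ≤ ‖y - w‖ + ‖w‖ := by simpa using norm_add_le (y - w) w
          rw [mem_ball_zero_iff]; linarith
        refine Complex.norm_deriv_le_of_forall_mem_sphere_norm_le hρ ?_
          fun y hy => hb y (hcb (Metric.sphere_subset_closedBall hy))
        exact (hd.mono hcb).diffContOnCl_ball subset_rfl
      have hda : ∀ w ∈ Metric.ball (0 : ℂ) (R - ρ), DifferentiableAt ℂ h w := fun w hw =>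
        hd.differentiableAt (Metric.isOpen_ball.mem_nhds (Metric.ball_subset_ball (by linarith) hw))
      have hm : ‖z + -1‖ ≤ ‖z‖ + 1 := by simpa using norm_add_le z (-1 : ℂ)
      have := (convex_ball (0 : ℂ) (R - ρ)).norm_image_sub_le_of_norm_deriv_le (f := h)
        (C := A / ρ) (x := z) (y := z + -1) hda hsub
        (by rw [mem_ball_zero_iff]; linarith) (by rw [mem_ball_zero_iff]; linarith)
      simpa [fwdDiff] using this
    · have : R - ((N + 1 : ℕ) : ℝ) * (ρ + 1) = R - (ρ + 1) - N * (ρ + 1) := by push_cast; ring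
      rwa [this] at hz

/-- The term `k_μ^d |k|^(-s)` of a lattice zeta series; it is `0` for `k = 0`. -/
def latticeTerm {n : ℕ} (μ : Fin n) (d : ℕ) (s : ℂ) (k : Mode n) : ℂ :=
  if k = 0 then 0 else (k μ : ℂ) ^ d * (modeNorm k : ℂ) ^ (-s)

/-- The unit vector `e_i` of the lattice. -/
abbrev unitMode {n : ℕ} (i : Fin n) : Mode n := Pi.single i 1

theorem modeNorm_sub_smul_unitMode_sq {n : ℕ} (k : Mode n) (i : Fin n) (j : ℕ) :
    modeNorm (k + j • (-unitMode i)) ^ 2 = modeNorm k ^ 2 - 2 * k i * j + j ^ 2 := by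
  rw [modeNorm_sq, modeNorm_sq, ← Finset.add_sum_erase _ _ (Finset.mem_univ i),
    ← Finset.add_sum_erase Finset.univ (fun i => (k i : ℝ) ^ 2) (Finset.mem_univ i)]
  have : ∑ x ∈ Finset.univ.erase i, (((k + j • (-unitMode i)) x : ℤ) : ℝ) ^ 2 =
      ∑ x ∈ Finset.univ.erase i, (k x : ℝ) ^ 2 :=
    Finset.sum_congr rfl fun x hx => by simp [Finset.ne_of_mem_erase hx]
  rw [this]
  simp
  ring

/-- The holomorphic extension of `z ↦ latticeTerm μ d s (k + z e_i)`. -/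
def latticeExt {n : ℕ} (μ i : Fin n) (d : ℕ) (s : ℂ) (k : Mode n) (z : ℂ) : ℂ :=
  ((k μ : ℂ) + if μ = i then z else 0) ^ d *
    (((modeNorm k ^ 2 : ℝ) : ℂ) + 2 * k i * z + z ^ 2) ^ (-s / 2)

/-- The squared norm, unlike the norm, is polynomial along a coordinate line; powers written in
terms of it extend to complex displacements. -/
theorem cpow_neg_eq_sq_cpow {x : ℝ} (hx : 0 < x) (s : ℂ) :
    (x : ℂ) ^ (-s) = ((x ^ 2 : ℝ) : ℂ) ^ (-s / 2) := by
  rw [Complex.cpow_def_of_ne_zero (by exact_mod_cast hx.ne'),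
    Complex.cpow_def_of_ne_zero (by exact_mod_cast (pow_pos hx 2).ne'),
    ← Complex.ofReal_log hx.le, ← Complex.ofReal_log (by positivity), Real.log_pow]
  congr 1
  push_cast
  ring

/-- The condition `j < |k|` keeps the shifted mode away from `0`, where `latticeTerm` takes its
default value: the squared norm after the shift is at least `(|k| - j)^2`. -/
theorem latticeTerm_eq_latticeExt {n : ℕ} (μ i : Fin n) (d : ℕ) (s : ℂ) (k : Mode n) (j : ℕ)
    (hj : (j : ℝ) < modeNorm k) :
    latticeTerm μ d s (k + j • (-unitMode i)) = latticeExt μ i d s k (0 + j • (-1 : ℂ)) := by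
  have hsq := modeNorm_sub_smul_unitMode_sq k i j
  have hj0 : (0 : ℝ) ≤ j := j.cast_nonneg
  have hki := abs_le.mp (abs_le_modeNorm k i)
  have hpos : 0 < modeNorm (k + j • (-unitMode i)) ^ 2 := by rw [hsq]; nlinarith
  have hne : k + j • (-unitMode i) ≠ 0 := by
    intro h
    rw [h, modeNorm_sq] at hpos
    simp at hpos
  rw [latticeTerm, if_neg hne, latticeExt, cpow_neg_eq_sq_cpow (modeNorm_pos hne), hsq]
  congr 2
  · by_cases h : μ = i
    · subst h; simp
    · simp [h]
  · push_cast; simp; ring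

theorem rpow_le_four_rpow_abs {x t : ℝ} (h1 : 1 / 4 ≤ x) (h2 : x ≤ 4) : x ^ t ≤ 4 ^ |t| := by
  have hx : 0 < x := by linarith
  rcases le_or_gt 0 t with ht | ht
  · rw [abs_of_nonneg ht]; exact Real.rpow_le_rpow hx.le h2 ht
  · rw [abs_of_neg ht, ← inv_inv x, Real.inv_rpow (by positivity), ← Real.rpow_neg (by positivity)]
    refine Real.rpow_le_rpow (by positivity) ?_ (by linarith)
    rw [inv_le_comm₀ hx (by norm_num)]; linarith

/-- On the disc of radius `|k| / 4` the perturbation of `|k|^2` is at most `(1/2 + 1/16) |k|^2`. The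
base of the complex power thus stays in the right half-plane, away from the branch cut, and
comparable to `|k|^2`. -/
theorem latticeExt_arg_bounds {n : ℕ} (i : Fin n) (k : Mode n) {z : ℂ}
    (hz : ‖z‖ < modeNorm k / 4) :
    ‖2 * (k i : ℂ) * z + z ^ 2‖ ≤ modeNorm k ^ 2 * (3 / 4) := by
  have h1 : ‖(k i : ℂ)‖ ≤ modeNorm k := by
    simpa using abs_le_modeNorm k i
  have h0 := modeNorm_nonneg k
  have hz0 := norm_nonneg z
  calc ‖2 * (k i : ℂ) * z + z ^ 2‖ ≤ 2 * ‖(k i : ℂ)‖ * ‖z‖ + ‖z‖ ^ 2 := by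
        refine (norm_add_le _ _).trans ?_
        simp
    _ ≤ 2 * modeNorm k * (modeNorm k / 4) + (modeNorm k / 4) ^ 2 := by gcongr
    _ ≤ _ := by nlinarith

theorem latticeExt_differentiableOn {n : ℕ} (μ i : Fin n) (d : ℕ) (s : ℂ) (k : Mode n) :
    DifferentiableOn ℂ (latticeExt μ i d s k) (Metric.ball 0 (modeNorm k / 4)) := by
  refine DifferentiableOn.mul ?_ ?_
  · refine DifferentiableOn.pow ?_ d
    split_ifs <;> fun_prop
  · refine DifferentiableOn.cpow_const (by fun_prop) fun z hz => Or.inl ?_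
    have hz' : ‖z‖ < modeNorm k / 4 := by simpa using hz
    have h := latticeExt_arg_bounds i k hz'
    have h2 := (abs_le.mp (Complex.abs_re_le_norm (2 * (k i : ℂ) * z + z ^ 2))).1
    have h3 : 0 < modeNorm k := by linarith [norm_nonneg z]
    rw [add_assoc, Complex.add_re, Complex.ofReal_re]
    nlinarith [pow_pos h3 2]

/-- The factor `2^d` comes from `|k_μ + z| ≤ 2 |k|`, the factor `4^b` from the modulus of the base
lying between `|k|^2 / 4` and `4 |k|^2`, and `exp (π b)` from its argument. The bound is uniform for
`‖s‖ ≤ b`. -/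
theorem norm_latticeExt_le {n : ℕ} (μ i : Fin n) (d : ℕ) {s : ℂ} {b : ℝ} (hs : ‖s‖ ≤ b)
    (k : Mode n) {z : ℂ} (hz : ‖z‖ < modeNorm k / 4) :
    ‖latticeExt μ i d s k z‖ ≤
      2 ^ d * 4 ^ b * Real.exp (Real.pi * b) * modeNorm k ^ ((d : ℝ) - s.re) := by
  have h := latticeExt_arg_bounds i k hz
  have h3 : 0 < modeNorm k := by linarith [norm_nonneg z]
  set L := modeNorm k
  have hb : 0 ≤ b := (norm_nonneg s).trans hs
  set w : ℂ := ((L ^ 2 : ℝ) : ℂ) + 2 * k i * z + z ^ 2 with hw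
  have hw' : w = ((L ^ 2 : ℝ) : ℂ) + (2 * k i * z + z ^ 2) := by rw [hw]; ring
  have hL2 : 0 < L ^ 2 := by positivity
  have hnL : ‖((L ^ 2 : ℝ) : ℂ)‖ = L ^ 2 := by
    rw [Complex.norm_real, Real.norm_of_nonneg hL2.le]
  have hu : ‖w‖ ≤ 4 * L ^ 2 := by
    rw [hw']; refine (norm_add_le _ _).trans ?_; rw [hnL]; linarith
  have hl : 1 / 4 * L ^ 2 ≤ ‖w‖ := by
    rw [hw']
    have := norm_sub_le_norm_add ((L ^ 2 : ℝ) : ℂ) (2 * k i * z + z ^ 2)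
    rw [hnL] at this; linarith
  have hA : ‖((k μ : ℂ) + if μ = i then z else 0) ^ d‖ ≤ 2 ^ d * L ^ (d : ℝ) := by
    rw [norm_pow, Real.rpow_natCast, ← mul_pow]
    refine pow_le_pow_left₀ (norm_nonneg _) ?_ d
    have h1 : ‖(k μ : ℂ)‖ ≤ L := by simpa using abs_le_modeNorm k μ
    refine (norm_add_le _ _).trans ?_
    split_ifs
    · linarith
    · rw [norm_zero]; linarith
  have hB : ‖w ^ (-s / 2)‖ ≤ 4 ^ b * L ^ (-s.re) * Real.exp (Real.pi * b) := by
    refine (Complex.norm_cpow_le _ _).trans ?_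
    rw [div_eq_mul_inv, ← Real.exp_neg]
    have hre : (-s / 2).re = -s.re / 2 := by simp
    have him : (-s / 2).im = -s.im / 2 := by simp
    rw [hre, him]
    refine mul_le_mul ?_ ?_ (Real.exp_pos _).le (by positivity)
    · have e1 : ‖w‖ = ‖w‖ / L ^ 2 * L ^ 2 := by field_simp
      have e2 : (L ^ 2) ^ (-s.re / 2) = L ^ (-s.re) := by
        rw [← Real.rpow_natCast, ← Real.rpow_mul h3.le]; congr 1; push_cast; ring
      rw [e1, Real.mul_rpow (by positivity) hL2.le, e2]
      refine mul_le_mul_of_nonneg_right ?_ (by positivity)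
      refine (rpow_le_four_rpow_abs ?_ ?_).trans (Real.rpow_le_rpow_of_exponent_le (by norm_num) ?_)
      · rwa [le_div_iff₀ hL2]
      · rwa [div_le_iff₀ hL2]
      · rw [abs_div, abs_neg]
        have := Complex.abs_re_le_norm s
        have h2 : |(2 : ℝ)| = 2 := by norm_num
        rw [h2]; linarith [abs_nonneg s.re]
    · rw [Real.exp_le_exp]
      have h1 := Complex.abs_arg_le_pi w
      have h2 := Complex.abs_im_le_norm s
      have h4 : -(w.arg * (-s.im / 2)) ≤ |w.arg| * |s.im| := by
        rw [← abs_mul]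
        have := le_abs_self (w.arg * s.im)
        have := abs_nonneg (w.arg * s.im)
        linarith
      exact h4.trans (mul_le_mul h1 (h2.trans hs) (abs_nonneg _) Real.pi_pos.le)
  rw [latticeExt, norm_mul]
  calc _ ≤ (2 ^ d * L ^ (d : ℝ)) * (4 ^ b * L ^ (-s.re) * Real.exp (Real.pi * b)) :=
        mul_le_mul hA hB (norm_nonneg _) (by positivity)
    _ = _ := by rw [sub_eq_add_neg, Real.rpow_add h3]; ring

/-- Each difference improves the decay by one power of `|k|`, since the function is holomorphic on a
disc whose radius is proportional to `|k|`. -/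
theorem norm_fwdDiff_latticeTerm_le {n : ℕ} (μ i : Fin n) (d N : ℕ) {s : ℂ} {b : ℝ} (hs : ‖s‖ ≤ b)
    (k : Mode n) (hk : 16 * (N + 1 : ℝ) ≤ modeNorm k) :
    ‖(fwdDiff (-unitMode i))^[N] (latticeTerm μ d s) k‖ ≤
      2 ^ d * 4 ^ b * Real.exp (Real.pi * b) * (16 * (N + 1)) ^ N *
        modeNorm k ^ ((d : ℝ) - s.re - N) := by
  have hN : (0 : ℝ) ≤ N := N.cast_nonneg
  have hL : 0 < modeNorm k := by linarith
  have e : (fwdDiff (-unitMode i))^[N] (latticeTerm μ d s) k =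
      (fwdDiff (-1 : ℂ))^[N] (latticeExt μ i d s k) 0 := by
    rw [fwdDiff_iter_eq_sum_shift, fwdDiff_iter_eq_sum_shift]
    refine Finset.sum_congr rfl fun j hj => ?_
    rw [latticeTerm_eq_latticeExt]
    have : (j : ℝ) ≤ N := by exact_mod_cast Nat.lt_succ_iff.mp (Finset.mem_range.mp hj)
    linarith
  -- With this radius, `N` steps consume `N ρ + N ≤ |k| / 16 + |k| / 16`, which leaves the centre
  -- inside the disc of radius `|k| / 4`.
  have hρ : 0 < modeNorm k / (16 * (N + 1)) := by positivity
  have := norm_fwdDiff_iter_le hρ N (A := 2 ^ d * 4 ^ b * Real.exp (Real.pi * b) *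
    modeNorm k ^ ((d : ℝ) - s.re)) (by positivity) (latticeExt_differentiableOn μ i d s k)
    (fun z hz => norm_latticeExt_le μ i d hs k (by simpa using hz)) 0 (by
      rw [mem_ball_zero_iff, norm_zero]
      have : N * (modeNorm k / (16 * (N + 1))) ≤ modeNorm k / 16 := by
        rw [mul_div_assoc', div_le_div_iff₀ (by positivity) (by norm_num)]
        nlinarith
      nlinarith)
  rw [e]
  refine this.trans (le_of_eq ?_)
  rw [Real.rpow_sub hL ((d : ℝ) - s.re) N, Real.rpow_natCast, div_pow]
  field_simp

/-! ## Weighted lattice zeta series -/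

theorem norm_latticeTerm_le {n : ℕ} (μ : Fin n) (d : ℕ) (s : ℂ) (k : Mode n) :
    ‖latticeTerm μ d s k‖ ≤ modeNorm k ^ ((d : ℝ) - s.re) := by
  unfold latticeTerm
  split_ifs with hk
  · simpa using Real.rpow_nonneg (modeNorm_nonneg k) _
  · have h := modeNorm_pos hk
    rw [norm_mul, norm_pow, Complex.norm_cpow_eq_rpow_re_of_pos h, sub_eq_add_neg, Real.rpow_add h,
      Real.rpow_natCast, Complex.neg_re]
    gcongr
    simpa using abs_le_modeNorm k μ

theorem summable_norm_latticeTerm {n : ℕ} (μ : Fin n) (d : ℕ) {s : ℂ} (hs : 2 * n + d ≤ s.re) :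
    Summable fun k => ‖latticeTerm μ d s k‖ :=
  Summable.of_nonneg_of_le (fun _ => norm_nonneg _) (norm_latticeTerm_le μ d s)
    (summable_modeNorm_rpow (by linarith))

/-- A crude bound, locally uniform in `s`, for the finitely many modes near the origin where the
Cauchy estimate is not available. -/
theorem norm_latticeTerm_le_of_norm_le {n : ℕ} (μ : Fin n) (d : ℕ) {s : ℂ} {b : ℝ} (hs : ‖s‖ ≤ b)
    (k : Mode n) : ‖latticeTerm μ d s k‖ ≤ (1 + modeNorm k) ^ (d + b) := by
  have h0 := modeNorm_nonneg k
  by_cases hk : k = 0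
  · rw [latticeTerm, if_pos hk, norm_zero]; positivity
  · have h1 := (abs_le.mp (Complex.abs_re_le_norm s)).1
    have h2 := (norm_nonneg s).trans hs
    calc ‖latticeTerm μ d s k‖ ≤ modeNorm k ^ ((d : ℝ) - s.re) := norm_latticeTerm_le μ d s k
      _ ≤ modeNorm k ^ (d + b) :=
          Real.rpow_le_rpow_of_exponent_le (one_le_modeNorm hk) (by linarith)
      _ ≤ _ := Real.rpow_le_rpow h0 (by linarith) (by positivity)

theorem differentiable_latticeTerm {n : ℕ} (μ : Fin n) (d : ℕ) (k : Mode n) :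
    Differentiable ℂ fun s => latticeTerm μ d s k := by
  unfold latticeTerm
  split_ifs with hk
  · fun_prop
  · have : (modeNorm k : ℂ) ≠ 0 := by exact_mod_cast (modeNorm_pos hk).ne'
    exact (differentiable_const _).mul fun s =>
      (differentiableAt_id.neg).const_cpow (Or.inl this)

theorem differentiable_fwdDiff_latticeTerm {n : ℕ} (μ i : Fin n) (d N : ℕ) (k : Mode n) :
    Differentiable ℂ fun s => (fwdDiff (-unitMode i))^[N] (latticeTerm μ d s) k := by
  simp only [fwdDiff_iter_eq_sum_shift]
  exact Differentiable.fun_sum fun j _ => (differentiable_latticeTerm μ d _).const_smul _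

/-- The `N`-th differences of the terms `k_μ^d |k|^(-s)`, weighted by a bounded sequence, have a
sum that is holomorphic for `Re s > 2 n + d - N`. -/
theorem differentiableOn_tsum_fwdDiff {n : ℕ} (μ i : Fin n) (d N : ℕ) {v : Mode n → ℂ} {C : ℝ}
    (hv : ∀ k, ‖v k‖ ≤ C) :
    DifferentiableOn ℂ (fun s => ∑' k, v k * (fwdDiff (-unitMode i))^[N] (latticeTerm μ d s) k)
      {s | 2 * n + d - N < s.re} := by
  have hC : 0 ≤ C := (norm_nonneg _).trans (hv 0)
  -- Differentiability is local, so it suffices to work on a bounded neighbourhood, where the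
  -- constants depending on `b` are uniform.
  intro s₀ hs₀
  set b : ℝ := ‖s₀‖ + 1
  have hb : 0 ≤ b := by positivity
  set U : Set ℂ := {s | 2 * n + d - N < s.re} ∩ Metric.ball 0 b
  have hU : IsOpen U := (isOpen_lt continuous_const Complex.continuous_re).inter Metric.isOpen_ball
  have hsU : s₀ ∈ U := ⟨hs₀, by simp [b]⟩
  set K : ℝ := 2 ^ d * 4 ^ b * Real.exp (Real.pi * b) * (16 * (N + 1)) ^ N
  -- The dominating series uses the decay estimate for large modes and the triangle inequality over
  -- the binomial sum for the finitely many others.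
  set u : Mode n → ℝ := fun k => if 16 * (N + 1 : ℝ) ≤ modeNorm k
    then C * (K * modeNorm k ^ (-(2 * n : ℝ)))
    else C * ∑ j ∈ Finset.range (N + 1), ‖(-1 : ℤ) ^ (N - j) * (N.choose j : ℤ)‖ *
      (1 + modeNorm (k + j • (-unitMode i))) ^ (d + b) with hu
  have hsum : Summable u := by
    have h1 : Summable fun k : Mode n => C * (K * modeNorm k ^ (-(2 * n : ℝ))) :=
      ((summable_modeNorm_rpow le_rfl).mul_left K).mul_left C
    refine (summable_congr_cofinite ?_).mpr h1
    rw [Filter.EventuallyEq, Filter.eventually_cofinite]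
    refine (finite_modeNorm_lt n (16 * (N + 1))).subset fun k hk => ?_
    by_contra h
    exact hk (if_pos (not_lt.mp h))
  have key := Complex.differentiableOn_tsum_of_summable_norm hsum
    (F := fun k s => v k * (fwdDiff (-unitMode i))^[N] (latticeTerm μ d s) k)
    (fun k => ((differentiable_fwdDiff_latticeTerm μ i d N k).const_mul _).differentiableOn) hU
    (fun k s hs => ?_)
  · exact (key.differentiableAt (hU.mem_nhds hsU)).differentiableWithinAt
  · have hsb : ‖s‖ ≤ b := by have := hs.2; rw [mem_ball_zero_iff] at this; exact this.le
    have hsre : 2 * n + d - N < s.re := hs.1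
    rw [norm_mul, hu]
    dsimp only
    split_ifs with hk
    · refine mul_le_mul (hv k) ?_ (norm_nonneg _) hC
      refine (norm_fwdDiff_latticeTerm_le μ i d N hsb k hk).trans ?_
      refine mul_le_mul_of_nonneg_left ?_ (by positivity)
      refine Real.rpow_le_rpow_of_exponent_le ?_ (by linarith)
      have : (0 : ℝ) ≤ N := N.cast_nonneg
      linarith
    · refine mul_le_mul (hv k) ?_ (norm_nonneg _) hC
      rw [fwdDiff_iter_eq_sum_shift]
      refine norm_sum_le_of_le _ fun j _ => ?_
      refine (norm_zsmul_le _ _).trans ?_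
      exact mul_le_mul_of_nonneg_left (norm_latticeTerm_le_of_norm_le μ d hsb _) (norm_nonneg _)

theorem summable_norm_fwdDiff {G : Type*} [AddCommGroup G] (e : G) {f : G → ℂ}
    (hf : Summable fun k => ‖f k‖) : Summable fun k => ‖fwdDiff e f k‖ :=
  Summable.of_nonneg_of_le (fun _ => norm_nonneg _) (fun _ => norm_sub_le _ _)
    (((Equiv.addRight e).summable_iff (f := fun k => ‖f k‖)).mpr hf |>.add hf)

theorem summable_norm_mul_of_bounded {ι : Type*} {v f : ι → ℂ} {C : ℝ} (hv : ∀ k, ‖v k‖ ≤ C)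
    (hf : Summable fun k => ‖f k‖) : Summable fun k => ‖v k * f k‖ :=
  Summable.of_nonneg_of_le (fun _ => norm_nonneg _) (fun k => by
    rw [norm_mul]; exact mul_le_mul_of_nonneg_right (hv k) (norm_nonneg _)) (hf.mul_left C)

/-- Summation by parts. -/
theorem tsum_fwdDiff_iter_mul {G : Type*} [AddCommGroup G] (e : G) (N : ℕ) :
    ∀ {v f : G → ℂ} {C : ℝ}, (∀ k, ‖v k‖ ≤ C) → Summable (fun k => ‖f k‖) →
      ∑' k, (fwdDiff e)^[N] v k * f k = ∑' k, v k * (fwdDiff (-e))^[N] f k := by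
  induction N with
  | zero => intros; rfl
  | succ N ih =>
    intro v f C hv hf
    have hv' : ∀ k, ‖fwdDiff e v k‖ ≤ C + C := fun k =>
      (norm_sub_le _ _).trans (add_le_add (hv _) (hv _))
    have hit : ∀ N : ℕ, Summable fun k => ‖(fwdDiff (-e))^[N] f k‖ := fun N => by
      induction N with
      | zero => exact hf
      | succ N ih => rw [Function.iterate_succ_apply']; exact summable_norm_fwdDiff _ ih
    rw [Function.iterate_succ_apply, ih hv' hf, Function.iterate_succ_apply']
    set g := (fwdDiff (-e))^[N] f
    have h1 : Summable fun k => v k * g k := (summable_norm_mul_of_bounded hv (hit N)).of_norm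
    have h2 : Summable fun k => v (k + e) * g k :=
      (summable_norm_mul_of_bounded (v := fun k => v (k + e)) (fun k => hv _) (hit N)).of_norm
    have h3 : Summable fun k => v k * g (k + -e) :=
      (summable_norm_mul_of_bounded hv
        (((Equiv.addRight (-e)).summable_iff (f := fun k => ‖g k‖)).mpr (hit N))).of_norm
    simp only [fwdDiff, sub_mul, mul_sub]
    rw [h2.tsum_sub h1, h3.tsum_sub h1, ← (Equiv.addRight (-e)).tsum_eq fun k => v (k + e) * g k]
    simp

/-- For every `N`, the function `w` on the lattice is a sum of `N`-th differences of bounded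
functions in the coordinate directions. -/
def IsDiffExact {n : ℕ} (w : Mode n → ℂ) : Prop :=
  ∀ N : ℕ, ∃ v : Fin n → Mode n → ℂ, (∃ C : ℝ, ∀ i k, ‖v i k‖ ≤ C) ∧
    ∀ k, w k = ∑ i, (fwdDiff (unitMode i))^[N] (v i) k

theorem norm_fwdDiff_iter_le_of_bounded {G : Type*} [AddCommGroup G] (e : G) (N : ℕ) {v : G → ℂ}
    {C : ℝ} (hv : ∀ k, ‖v k‖ ≤ C) (k : G) : ‖(fwdDiff e)^[N] v k‖ ≤ 2 ^ N * C := by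
  induction N generalizing k with
  | zero => simpa using hv k
  | succ N ih =>
    rw [Function.iterate_succ_apply', pow_succ]
    refine (norm_sub_le _ _).trans ((add_le_add (ih _) (ih _)).trans_eq (by ring))

/-- Functions that are holomorphic on half-planes exhausting `ℂ`, and agree for `Re s` large, are
restrictions of an entire function. -/
theorem exists_entire_of_halfPlanes {a : ℝ} (f : ℂ → ℂ) (F : ℕ → ℂ → ℂ)
    (hF : ∀ N, DifferentiableOn ℂ (F N) {s | a - N < s.re})
    (hf : ∀ N s, a ≤ s.re → F N s = f s) :
    ∃ G : ℂ → ℂ, Differentiable ℂ G ∧ ∀ s : ℂ, a ≤ s.re → G s = f s := by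
  have hopen : ∀ N : ℕ, IsOpen {s : ℂ | a - N < s.re} := fun N =>
    isOpen_lt continuous_const Complex.continuous_re
  have hmono : ∀ {M N : ℕ}, M ≤ N → {s : ℂ | a - M < s.re} ⊆ {s : ℂ | a - N < s.re} := by
    intro M N h s hs
    have : (M : ℝ) ≤ N := by exact_mod_cast h
    simp only [Set.mem_ofPred_eq] at hs ⊢
    linarith
  have heq : ∀ {M N : ℕ}, M ≤ N → Set.EqOn (F M) (F N) {s | a - M < s.re} := by
    intro M N h
    -- Identity theorem on a half-plane, started at `a + 1`, near which both functions equal `f`.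
    refine AnalyticOnNhd.eqOn_of_preconnected_of_eventuallyEq (z₀ := ((a + 1 : ℝ) : ℂ))
      ((hF M).analyticOnNhd (hopen M)) (((hF N).mono (hmono h)).analyticOnNhd (hopen M))
      (convex_halfSpace_re_gt _).isPreconnected ?_ ?_
    · have : (0 : ℝ) ≤ M := M.cast_nonneg
      simp only [Set.mem_ofPred_eq, Complex.ofReal_re]; linarith
    · have : {s : ℂ | a < s.re} ∈ nhds ((a + 1 : ℝ) : ℂ) :=
        (isOpen_lt continuous_const Complex.continuous_re).mem_nhds (by simp)
      filter_upwards [this] with s hs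
      rw [hf M s (le_of_lt hs), hf N s (le_of_lt hs)]
  have hN : ∀ s : ℂ, ∃ N : ℕ, a - N < s.re := fun s => by
    obtain ⟨N, hN⟩ := exists_nat_gt (a - s.re)
    exact ⟨N, by linarith⟩
  choose ν hν using hN
  have hG : ∀ N s, a - (N : ℕ) < s.re → F (ν s) s = F N s := by
    intro N s hs
    rcases le_total (ν s) N with h | h
    · exact heq h (hν s)
    · exact (heq h hs).symm
  refine ⟨fun s => F (ν s) s, fun s => ?_, fun s hs => hf _ s hs⟩
  have h1 : (fun s => F (ν s) s) =ᶠ[nhds s] F (ν s) := by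
    filter_upwards [(hopen (ν s)).mem_nhds (hν s)] with z hz using hG _ _ hz
  exact (((hF _).differentiableAt ((hopen (ν s)).mem_nhds (hν s)))).congr_of_eventuallyEq h1

/-- The zeta series with a difference-exact weight extends to an entire function. -/
theorem IsDiffExact.exists_entire {n : ℕ} {w : Mode n → ℂ} (hw : IsDiffExact w) (μ : Fin n)
    (d : ℕ) : ∃ G : ℂ → ℂ, Differentiable ℂ G ∧
      ∀ s : ℂ, 2 * n + d ≤ s.re → G s = ∑' k, w k * latticeTerm μ d s k := by
  choose v hv hwv using hw
  refine exists_entire_of_halfPlanes (a := 2 * n + d) _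
    (fun N s => ∑ i, ∑' k, v N i k * (fwdDiff (-unitMode i))^[N] (latticeTerm μ d s) k) ?_ ?_
  · intro N
    obtain ⟨C, hC⟩ := hv N
    exact DifferentiableOn.fun_sum fun i _ => differentiableOn_tsum_fwdDiff μ i d N (hC i)
  · intro N s hs
    obtain ⟨C, hC⟩ := hv N
    have hsum := summable_norm_latticeTerm μ d hs
    simp only [hwv N, Finset.sum_mul]
    rw [Summable.tsum_finsetSum]
    · exact Finset.sum_congr rfl fun i _ => (tsum_fwdDiff_iter_mul _ N (hC i) hsum).symm
    · exact fun i _ => (summable_norm_mul_of_bounded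
        (norm_fwdDiff_iter_le_of_bounded _ N (hC i)) hsum).of_norm

/-! ## Constant and almost periodic weights -/

/-- The character `k ↦ (-1)^(k_i)`. -/
def parity {n : ℕ} (i : Fin n) (k : Mode n) : ℂ := (-1 : ℂ) ^ (k i)

theorem norm_parity {n : ℕ} (i : Fin n) (k : Mode n) : ‖parity i k‖ = 1 := by
  simp [parity, norm_zpow]

theorem parity_add_unitMode {n : ℕ} (i j : Fin n) (k : Mode n) :
    parity j (k + unitMode i) = if j = i then -parity j k else parity j k := by
  split_ifs with h
  · subst h; simp [parity, zpow_add₀]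
  · simp [parity, h]

theorem fwdDiff_iter_of_fwdDiff_eq {G : Type*} [AddCommGroup G] {e : G} {v : G → ℂ} {c : ℂ}
    (h : ∀ k, v (k + e) - v k = c * v k) (N : ℕ) (k : G) :
    (fwdDiff e)^[N] v k = c ^ N * v k := by
  induction N generalizing k with
  | zero => simp
  | succ N ih =>
    rw [Function.iterate_succ_apply', fwdDiff, ih, ih, ← mul_sub, h]; ring

/-- In the ordered expansion `∏ (1 + p_i) - 1 = ∑ p_i ∏_{j < i} (1 + p_j)`, the `i`-th term changes
sign under translation by `e_i`. It is an eigenvector of the difference in that direction with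
eigenvalue `-2`, so dividing by `(-2)^N` inverts the `N`-th difference. -/
theorem isDiffExact_prod_parity (n : ℕ) :
    IsDiffExact fun k : Mode n => ∏ i, (1 + parity i k) - 1 := by
  intro N
  set u : Fin n → Mode n → ℂ := fun i k =>
    parity i k * ∏ j ∈ Finset.univ.filter (· < i), (1 + parity j k) with hu
  refine ⟨fun i k => ((-2 : ℂ) ^ N)⁻¹ * u i k, ⟨‖((-2 : ℂ) ^ N)⁻¹‖ * 2 ^ n, fun i k => ?_⟩,
    fun k => ?_⟩
  · rw [norm_mul, hu]
    refine mul_le_mul_of_nonneg_left ?_ (norm_nonneg _)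
    rw [norm_mul, norm_parity, one_mul, norm_prod]
    calc ∏ j ∈ Finset.univ.filter (· < i), ‖1 + parity j k‖
        ≤ ∏ j ∈ Finset.univ.filter (· < i), (2 : ℝ) := by
          refine Finset.prod_le_prod (fun _ _ => norm_nonneg _) fun j _ => ?_
          refine (norm_add_le _ _).trans ?_
          rw [norm_parity, norm_one]; norm_num
      _ ≤ 2 ^ n := by
          rw [Finset.prod_const]
          exact pow_le_pow_right₀ (by norm_num) ((Finset.card_le_univ _).trans (by simp))
  · have key : ∀ i, (fwdDiff (unitMode i))^[N] (fun k => ((-2 : ℂ) ^ N)⁻¹ * u i k) k = u i k := by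
      intro i
      rw [fwdDiff_iter_of_fwdDiff_eq (c := -2)]
      · rw [mul_inv_cancel_left₀ (pow_ne_zero _ (by norm_num))]
      · intro k
        have : u i (k + unitMode i) = -u i k := by
          simp only [hu, parity_add_unitMode, if_true, neg_mul]
          congr 2
          refine Finset.prod_congr rfl fun j hj => ?_
          rw [if_neg (Finset.mem_filter.mp hj).2.ne]
        rw [this]; ring
    refine Eq.trans ?_ (Finset.sum_congr rfl fun i _ => (key i).symm)
    change ∏ i, (1 + parity i k) - 1 = ∑ i, u i k
    rw [Finset.prod_one_add_ordered, add_sub_cancel_left]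

open scoped Classical in
-- Orthogonality of characters of `(ℤ/2)^n`: the product is the sum of all of them.
theorem prod_one_add_parity {n : ℕ} (k : Mode n) :
    ∏ i, (1 + parity i k) = if k ∈ Set.range (fun j : Mode n => (2 : ℕ) • j) then 2 ^ n else 0 := by
  split_ifs with h
  · obtain ⟨j, rfl⟩ := h
    have : ∀ i, 1 + parity i ((2 : ℕ) • j) = 2 := fun i => by
      rw [parity, Even.neg_one_zpow ⟨j i, by simp [two_mul]⟩]; norm_num
    rw [Finset.prod_congr rfl fun i _ => this i]; simp
  · have : ∃ i, ¬ Even (k i) := by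
      by_contra hc
      push Not at hc
      choose j hj using fun i => (hc i).two_dvd
      exact h ⟨j, by funext i; simp [hj i]⟩
    obtain ⟨i, hi⟩ := this
    refine Finset.prod_eq_zero (Finset.mem_univ i) ?_
    rw [parity, (Int.not_even_iff_odd.mp hi).neg_one_zpow]; ring

theorem latticeTerm_two_nsmul {n : ℕ} (μ : Fin n) (d : ℕ) (s : ℂ) (k : Mode n) :
    latticeTerm μ d s ((2 : ℕ) • k) = (2 : ℂ) ^ ((d : ℂ) - s) * latticeTerm μ d s k := by
  have h2 : (2 : ℕ) • k = 0 ↔ k = 0 := smul_eq_zero_iff_right two_ne_zero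
  have hn : modeNorm ((2 : ℕ) • k) = 2 * modeNorm k := by
    have h0 := modeNorm_nonneg k
    rw [← sq_eq_sq₀ (modeNorm_nonneg _) (by positivity), mul_pow, modeNorm_sq, modeNorm_sq,
      Finset.mul_sum]
    refine Finset.sum_congr rfl fun i _ => ?_
    simp [mul_pow]
  simp only [latticeTerm, h2]
  split_ifs with hk
  · simp
  · rw [hn, Complex.ofReal_mul, Complex.mul_cpow_ofReal_nonneg (by norm_num) (modeNorm_nonneg k),
      sub_eq_add_neg, Complex.cpow_add _ _ two_ne_zero, Complex.cpow_natCast]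
    simp [mul_pow]
    ring

/-- The weight restricts the sum to `2ℤⁿ` with mass `2^n`; homogeneity of degree `d - s` supplies
the remaining power of two. -/
theorem tsum_prod_parity_mul_latticeTerm {n : ℕ} (μ : Fin n) (d : ℕ) (s : ℂ) :
    ∑' k, (∏ i, (1 + parity i k)) * latticeTerm μ d s k =
      (2 : ℂ) ^ ((n : ℂ) + d - s) * ∑' k, latticeTerm μ d s k := by
  have hinj : Function.Injective fun j : Mode n => (2 : ℕ) • j := fun a b h => by
    have h : (2 : ℕ) • a = (2 : ℕ) • b := h
    funext i
    have := congrFun h i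
    simp at this
    exact this
  rw [← hinj.tsum_eq, ← tsum_mul_left]
  · refine tsum_congr fun k => ?_
    rw [prod_one_add_parity, if_pos ⟨k, rfl⟩, latticeTerm_two_nsmul, add_sub_assoc,
      Complex.cpow_add _ _ two_ne_zero, Complex.cpow_natCast, mul_assoc]
  · intro k hk
    by_contra hc
    refine hk ?_
    change (∏ i, (1 + parity i k)) * latticeTerm μ d s k = 0
    rw [prod_one_add_parity, if_neg hc, zero_mul]

/-- The zeta series whose weight is a constant plus a difference-exact function extends to a
meromorphic function, which is analytic at all real points except possibly `n + d`. -/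
theorem exists_meromorphic_extension {n : ℕ} {w : Mode n → ℂ} {c : ℂ}
    (hw : IsDiffExact fun k => w k - c) (μ : Fin n) (d : ℕ) :
    ∃ G : ℂ → ℂ, Meromorphic G ∧ (∀ x : ℝ, x ≠ n + d → AnalyticAt ℂ G x) ∧
      ∀ s : ℂ, 2 * n + d ≤ s.re → HasSum (fun k => w k * latticeTerm μ d s k) (G s) := by
  obtain ⟨G₁, hG₁, hG₁s⟩ := hw.exists_entire μ d
  obtain ⟨G₂, hG₂, hG₂s⟩ := (isDiffExact_prod_parity n).exists_entire μ d
  -- The case `N = 0` of difference-exactness is boundedness.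
  have hwb : ∃ C : ℝ, ∀ k, ‖w k - c‖ ≤ C := by
    obtain ⟨v, ⟨C, hC⟩, hv⟩ := hw 0
    refine ⟨∑ _i : Fin n, C, fun k => ?_⟩
    refine (congrArg norm (hv k)).trans_le ?_
    exact norm_sum_le_of_le _ fun i _ => hC i k
  obtain ⟨C, hC⟩ := hwb
  -- Positivity of `n` puts the half-plane `Re s ≥ 2n + d` strictly to the right of the critical
  -- line `Re s = n + d`.
  have hn : (0 : ℝ) < n := by exact_mod_cast μ.pos
  -- The factor relating the series to its entire multiple `G₂`. Its zeros have `|2^(n+d-s)| = 1`,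
  -- hence `Re s = n + d`; the only real one is `n + d`.
  set q : ℂ → ℂ := fun s => (2 : ℂ) ^ ((n : ℂ) + d - s) - 1 with hq
  have hqd : Differentiable ℂ q := by
    refine Differentiable.sub_const (fun s => ?_) 1
    exact DifferentiableAt.const_cpow (by fun_prop) (Or.inl two_ne_zero)
  have hqne : ∀ s : ℂ, s.re ≠ n + d → q s ≠ 0 := by
    intro s hs h0
    have h1 : ‖(2 : ℂ) ^ ((n : ℂ) + d - s)‖ = 1 := by rw [sub_eq_zero.mp h0, norm_one]
    have h2 := Complex.norm_cpow_eq_rpow_re_of_pos (x := 2) (by norm_num) ((n : ℂ) + d - s)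
    rw [Complex.ofReal_ofNat, h1] at h2
    have h3 := congrArg Real.log h2
    rw [Real.log_one, Real.log_rpow (by norm_num), zero_eq_mul,
      or_iff_left (Real.log_pos one_lt_two).ne'] at h3
    simp at h3
    exact hs (by linarith)
  refine ⟨fun s => G₁ s + c * (G₂ s / q s), fun s => ?_, fun x hx => ?_, fun s hs => ?_⟩
  · exact (hG₁.analyticAt s).meromorphicAt.add ((MeromorphicAt.const c s).mul
      ((hG₂.analyticAt s).meromorphicAt.div (hqd.analyticAt s).meromorphicAt))
  · exact (hG₁.analyticAt x).add (analyticAt_const.mul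
      ((hG₂.analyticAt x).div (hqd.analyticAt x) (hqne x (by simpa using hx))))
  · have hsum := summable_norm_latticeTerm μ d hs
    have hp : ∀ k : Mode n, ‖∏ i, (1 + parity i k)‖ ≤ 2 ^ n := fun k => by
      rw [prod_one_add_parity]; split_ifs <;> simp
    have h1 : G₂ s = q s * ∑' k, latticeTerm μ d s k := by
      rw [hG₂s s hs, hq, sub_mul, ← tsum_prod_parity_mul_latticeTerm, one_mul,
        ← Summable.tsum_sub (summable_norm_mul_of_bounded hp hsum).of_norm hsum.of_norm]
      simp only [sub_mul, one_mul]
    have h2 : G₂ s / q s = ∑' k, latticeTerm μ d s k := by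
      rw [h1, mul_div_cancel_left₀ _ (hqne s (by linarith))]
    have h3 := (summable_norm_mul_of_bounded hC hsum).of_norm.hasSum
    have h4 := h3.add (hsum.of_norm.hasSum.mul_left c)
    rw [← hG₁s s hs, ← h2] at h4
    refine h4.congr_fun fun k => ?_
    ring

/-! ### Series of characters and small divisors. -/

theorem fwdDiff_iter_tsum {n : ℕ} {ι : Type*} {χ : ι → Mode n → ℂ} {z : ι → Fin n → ℂ}
    (hχ : ∀ t i k, χ t (k + unitMode i) = z t i * χ t k) (hχ1 : ∀ t k, ‖χ t k‖ ≤ 1)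
    (hz : ∀ t i, ‖z t i‖ ≤ 1) (i : Fin n) (N : ℕ) :
    ∀ {b : ι → ℂ}, Summable (fun t => ‖b t‖) → ∀ k,
      (fwdDiff (unitMode i))^[N] (fun k => ∑' t, b t * χ t k) k =
        ∑' t, (z t i - 1) ^ N * b t * χ t k := by
  have hs : ∀ {b : ι → ℂ}, Summable (fun t => ‖b t‖) → ∀ k, Summable fun t => b t * χ t k :=
    fun hb k => by
      simpa only [mul_comm] using (summable_norm_mul_of_bounded (fun t => hχ1 t k) hb).of_norm
  induction N with
  | zero => intro b hb k; simp
  | succ N ih =>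
    intro b hb k
    have hz2 : ∀ t, ‖z t i - 1‖ ≤ 2 := fun t =>
      (norm_sub_le _ _).trans (by rw [norm_one]; linarith [hz t i])
    have e : fwdDiff (unitMode i) (fun k => ∑' t, b t * χ t k) =
        fun k => ∑' t, ((z t i - 1) * b t) * χ t k := by
      funext k
      rw [fwdDiff, ← (hs hb _).tsum_sub (hs hb _)]
      refine tsum_congr fun t => ?_
      rw [hχ]; ring
    rw [Function.iterate_succ_apply, e, ih (summable_norm_mul_of_bounded hz2 hb)]
    exact tsum_congr fun t => by ring

/-- An absolutely convergent series of nontrivial characters is difference-exact, provided that the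
small divisors `z - 1` are controlled by the coefficients. -/
theorem isDiffExact_tsum {n : ℕ} {ι : Type*} {χ : ι → Mode n → ℂ} {z : ι → Fin n → ℂ} {c : ι → ℂ}
    (hχ : ∀ t i k, χ t (k + unitMode i) = z t i * χ t k) (hχ1 : ∀ t k, ‖χ t k‖ ≤ 1)
    (hz : ∀ t i, ‖z t i‖ ≤ 1) (j : ι → Fin n) (hj : ∀ t, c t ≠ 0 → z t (j t) ≠ 1)
    (hc : ∀ N : ℕ, Summable fun t => ‖((z t (j t) - 1) ^ N)⁻¹ * c t‖) :
    IsDiffExact fun k => ∑' t, c t * χ t k := by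
  intro N
  classical
  -- Each character is assigned to one direction `j t` in which it is nontrivial, and its `N`-th
  -- difference there is undone by dividing by `(z - 1)^N`.
  set b : Fin n → ι → ℂ := fun i t => if j t = i then ((z t (j t) - 1) ^ N)⁻¹ * c t else 0 with hb
  have hbs : ∀ i, Summable fun t => ‖b i t‖ := fun i =>
    Summable.of_nonneg_of_le (fun _ => norm_nonneg _) (fun t => by
      simp only [hb]; split_ifs <;> simp; positivity) (hc N)
  have hbχ : ∀ i k t, ‖b i t * χ t k‖ ≤ ‖b i t‖ := fun i k t => by
    rw [norm_mul]; exact mul_le_of_le_one_right (norm_nonneg _) (hχ1 t k)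
  refine ⟨fun i k => ∑' t, b i t * χ t k, ⟨∑ i, ∑' t, ‖b i t‖, fun i k => ?_⟩, fun k => ?_⟩
  · refine (tsum_of_norm_bounded (hbs i).hasSum (hbχ i k)).trans ?_
    exact Finset.single_le_sum (f := fun i => ∑' t, ‖b i t‖)
      (fun i _ => tsum_nonneg fun t => norm_nonneg _) (Finset.mem_univ i)
  · simp only [fwdDiff_iter_tsum hχ hχ1 hz _ N (hbs _)]
    have hterm : ∀ i t, (z t i - 1) ^ N * b i t * χ t k = if j t = i then c t * χ t k else 0 := by
      intro i t
      simp only [hb]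
      split_ifs with h
      · subst h
        by_cases h0 : c t = 0
        · simp [h0]
        · rw [mul_inv_cancel_left₀ (pow_ne_zero N (sub_ne_zero.mpr (hj t h0)))]
      · simp
    simp only [hterm]
    have hcs : Summable fun t => ‖c t * χ t k‖ := by
      have h0 := hc 0
      simp only [pow_zero, inv_one, one_mul] at h0
      exact Summable.of_nonneg_of_le (fun _ => norm_nonneg _) (fun t => by
        rw [norm_mul]; exact mul_le_of_le_one_right (norm_nonneg _) (hχ1 t k)) h0
    rw [← Summable.tsum_finsetSum]
    · simp
    · intro i _
      refine Summable.of_norm_bounded hcs fun t => ?_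
      split_ifs
      · exact le_rfl
      · rw [norm_zero]; exact norm_nonneg _

/-! ## The algebra of smooth combinations of left and right multiplications -/

theorem norm_exp_mul_ofReal_eq_one {c : ℂ} (hc : c.re = 0) (x : ℝ) :
    ‖Complex.exp (c * (x : ℂ))‖ = 1 := by
  rw [Complex.norm_exp]; simp [hc]

/-- The operator `U_r ⊗ v ↦ e^(-(i/2) (l - m).Θ(r + l + m)) U_(r + l + m) ⊗ M v`, where
`g = (l, m)`: up to a phase, left multiplication by `U_l` and right multiplication by `U_m`. -/
def torusOp {n : ℕ} (Θ : Matrix (Fin n) (Fin n) ℝ) (g : Mode n × Mode n)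
    (M : Spinor n →L[ℂ] Spinor n) : Hil n →L[ℂ] Hil n :=
  blockOp (Equiv.subRight (g.1 + g.2))
    (fun k => Complex.exp (-(Complex.I / 2) * (pairing Θ (g.1 - g.2) k : ℂ)) • M) ‖M‖ (fun k v => by
      rw [smul_apply, norm_smul, norm_exp_mul_ofReal_eq_one (by simp), one_mul]
      exact M.le_opNorm v)

theorem torusOp_apply {n : ℕ} (Θ : Matrix (Fin n) (Fin n) ℝ) (g : Mode n × Mode n)
    (M : Spinor n →L[ℂ] Spinor n) (ψ : Hil n) (k : Mode n) :
    torusOp Θ g M ψ k = Complex.exp (-(Complex.I / 2) * (pairing Θ (g.1 - g.2) k : ℂ)) •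
      M (ψ (k - (g.1 + g.2))) := rfl

theorem norm_torusOp_le {n : ℕ} (Θ : Matrix (Fin n) (Fin n) ℝ) (g : Mode n × Mode n)
    (M : Spinor n →L[ℂ] Spinor n) : ‖torusOp Θ g M‖ ≤ ‖M‖ :=
  (norm_blockOp_le _ _ _ _).trans (abs_norm M).le

theorem smul_torusOp {n : ℕ} (Θ : Matrix (Fin n) (Fin n) ℝ) (c : ℂ) (g : Mode n × Mode n)
    (M : Spinor n →L[ℂ] Spinor n) : c • torusOp Θ g M = torusOp Θ g (c • M) := by
  ext ψ : 1
  ext1; funext k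
  simp only [smul_apply, lp.coeFn_smul, Pi.smul_apply, torusOp_apply]
  rw [smul_comm]

theorem pairing_sub_right {n : ℕ} (Θ : Matrix (Fin n) (Fin n) ℝ) (k q r : Mode n) :
    pairing Θ k (q - r) = pairing Θ k q - pairing Θ k r := by
  simp only [pairing, ← Finset.sum_sub_distrib]
  refine Finset.sum_congr rfl fun i _ => Finset.sum_congr rfl fun j _ => ?_
  rw [Pi.sub_apply, Int.cast_sub]; ring

theorem pairing_add_right {n : ℕ} (Θ : Matrix (Fin n) (Fin n) ℝ) (k q r : Mode n) :
    pairing Θ k (q + r) = pairing Θ k q + pairing Θ k r := by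
  simp only [pairing, ← Finset.sum_add_distrib]
  refine Finset.sum_congr rfl fun i _ => Finset.sum_congr rfl fun j _ => ?_
  rw [Pi.add_apply, Int.cast_add]; ring

theorem pairing_add_left {n : ℕ} (Θ : Matrix (Fin n) (Fin n) ℝ) (k q r : Mode n) :
    pairing Θ (k + q) r = pairing Θ k r + pairing Θ q r := by
  simp only [pairing, ← Finset.sum_add_distrib]
  refine Finset.sum_congr rfl fun i _ => Finset.sum_congr rfl fun j _ => ?_
  rw [Pi.add_apply, Int.cast_add]; ring

theorem pairing_neg_right {n : ℕ} (Θ : Matrix (Fin n) (Fin n) ℝ) (k q : Mode n) :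
    pairing Θ k (-q) = -pairing Θ k q := by
  simp [pairing]

/-- Frequencies add and the phases combine into a scalar of modulus one that does not depend on the
mode; this makes the smooth operators an algebra. -/
theorem torusOp_mul_torusOp {n : ℕ} (Θ : Matrix (Fin n) (Fin n) ℝ) (g h : Mode n × Mode n)
    (M N : Spinor n →L[ℂ] Spinor n) :
    torusOp Θ g M * torusOp Θ h N = torusOp Θ (g + h)
      (Complex.exp ((Complex.I / 2) * (pairing Θ (h.1 - h.2) (g.1 + g.2) : ℂ)) • (M * N)) := by
  ext ψ : 1
  ext1; funext k
  have e1 : k - (g.1 + g.2) - (h.1 + h.2) = k - ((g + h).1 + (g + h).2) := by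
    simp only [Prod.fst_add, Prod.snd_add]; abel
  have e2 : (g + h).1 - (g + h).2 = (g.1 - g.2) + (h.1 - h.2) := by
    simp only [Prod.fst_add, Prod.snd_add]; abel
  simp only [mul_apply_eq_comp, torusOp_apply, smul_apply, map_smul, smul_smul, e1]
  rw [e2, pairing_add_left, pairing_sub_right, ← Complex.exp_add, ← Complex.exp_add]
  congr 2
  push_cast
  ring

/-- In `torusOp` the phase is evaluated at the target mode, in `weyl` at the source; the difference
is the constant phase of `l.Θl`. -/
theorem weyl_eq_torusOp {n : ℕ} (Θ : Matrix (Fin n) (Fin n) ℝ) (l : Mode n)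
    (M : Spinor n →L[ℂ] Spinor n) :
    weyl Θ l M = torusOp Θ (l, 0) (Complex.exp ((Complex.I / 2) * (pairing Θ l l : ℂ)) • M) := by
  ext ψ : 1
  ext1; funext k
  simp only [torusOp_apply, weyl, blockOp_apply, smul_apply, smul_smul, ← Complex.exp_add,
    pairing_sub_right, sub_zero, add_zero, Equiv.subRight_apply]
  congr 2
  push_cast
  ring

/-- `C₀ M C₀⁻¹`. -/
def conjC0 {n : ℕ} (S : SpinStructure n) (M : Spinor n →L[ℂ] Spinor n) :
    Spinor n →L[ℂ] Spinor n :=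
  S.C0.toContinuousLinearEquiv.toContinuousLinearMap.comp
    (M.comp S.C0.symm.toContinuousLinearEquiv.toContinuousLinearMap)

theorem conjC0_apply {n : ℕ} (S : SpinStructure n) (M : Spinor n →L[ℂ] Spinor n) (v : Spinor n) :
    conjC0 S M v = S.C0 (M (S.C0.symm v)) := rfl

theorem norm_conjC0_le {n : ℕ} (S : SpinStructure n) (M : Spinor n →L[ℂ] Spinor n) :
    ‖conjC0 S M‖ ≤ ‖M‖ := by
  refine ContinuousLinearMap.opNorm_le_bound _ (norm_nonneg _) fun v => ?_
  rw [conjC0_apply, LinearIsometryEquiv.norm_map]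
  exact (M.le_opNorm _).trans_eq (by rw [LinearIsometryEquiv.norm_map])

/-- `J` exchanges left and right multiplications. Under `(l, m) ↦ (-m, -l)` the difference `l - m`
is unchanged, and the sign from `k ↦ -k` is undone by complex conjugation of the phase. -/
theorem conjJ_torusOp {n : ℕ} (Θ : Matrix (Fin n) (Fin n) ℝ) (S : SpinStructure n)
    (g : Mode n × Mode n) (M : Spinor n →L[ℂ] Spinor n) :
    conjJ S (torusOp Θ g M) = torusOp Θ (-g.2, -g.1) (conjC0 S M) := by
  ext ψ : 1
  ext1; funext k
  have e1 : -(-k - (g.1 + g.2)) = k - (-g.2 + -g.1) := by abel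
  have e2 : -g.2 - -g.1 = g.1 - g.2 := by abel
  change S.C0 (Complex.exp (-(Complex.I / 2) * (pairing Θ (g.1 - g.2) (-k) : ℂ)) •
    M (S.C0.symm (ψ (-(-k - (g.1 + g.2)))))) = _
  rw [torusOp_apply, conjC0_apply, e1, e2, LinearIsometryEquiv.map_smulₛₗ, pairing_neg_right,
    ← Complex.exp_conj]
  congr 2
  simp only [map_mul, map_neg, map_div₀, Complex.conj_I, map_ofNat, Complex.conj_ofReal]
  push_cast
  ring

/-- The operators `∑ᵢ torusOp Θ (g i) (M i)` with frequencies `g i` in `H` and rapidly decaying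
coefficients. -/
def IsSmoothOp {n : ℕ} (Θ : Matrix (Fin n) (Fin n) ℝ) (H : AddSubgroup (Mode n × Mode n))
    (T : Hil n →L[ℂ] Hil n) : Prop :=
  ∃ (ι : Type) (g : ι → Mode n × Mode n) (M : ι → Spinor n →L[ℂ] Spinor n),
    (∀ i, g i ∈ H) ∧ (∀ r : ℕ, Summable fun i => (1 + ‖g i‖) ^ r * ‖M i‖) ∧
      HasSum (fun i => torusOp Θ (g i) (M i)) T

theorem summable_norm_torusOp {n : ℕ} (Θ : Matrix (Fin n) (Fin n) ℝ) {ι : Type*}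
    {g : ι → Mode n × Mode n} {M : ι → Spinor n →L[ℂ] Spinor n} (h : Summable fun i => ‖M i‖) :
    Summable fun i => ‖torusOp Θ (g i) (M i)‖ :=
  Summable.of_nonneg_of_le (fun _ => norm_nonneg _) (fun _ => norm_torusOp_le _ _ _) h

theorem one_add_norm_add_le {E : Type*} [SeminormedAddGroup E] (x y : E) :
    1 + ‖x + y‖ ≤ (1 + ‖x‖) * (1 + ‖y‖) := by
  nlinarith [norm_add_le x y, norm_nonneg x, norm_nonneg y, mul_nonneg (norm_nonneg x) (norm_nonneg y)]

/-- The algebra of smooth operators with frequencies in `H`. -/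
def smoothAlg {n : ℕ} (Θ : Matrix (Fin n) (Fin n) ℝ) (H : AddSubgroup (Mode n × Mode n)) :
    Subalgebra ℂ (Hil n →L[ℂ] Hil n) where
  carrier := {T | IsSmoothOp Θ H T}
  mul_mem' := by
    rintro T T' ⟨ι, g, M, hg, hM, hT⟩ ⟨ι', g', M', hg', hM', hT'⟩
    refine ⟨ι × ι', fun p => g p.1 + g' p.2, fun p =>
      Complex.exp ((Complex.I / 2) * (pairing Θ ((g' p.2).1 - (g' p.2).2)
        ((g p.1).1 + (g p.1).2) : ℂ)) • (M p.1 * M' p.2), fun p => H.add_mem (hg _) (hg' _),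
      fun r => ?_, ?_⟩
    · refine Summable.of_nonneg_of_le (fun p => by positivity) (fun p => ?_)
        ((hM r).mul_of_nonneg (hM' r) (fun _ => by positivity) (fun _ => by positivity))
      rw [norm_smul, norm_exp_mul_ofReal_eq_one (by simp), one_mul]
      calc (1 + ‖g p.1 + g' p.2‖) ^ r * ‖M p.1 * M' p.2‖
          ≤ ((1 + ‖g p.1‖) * (1 + ‖g' p.2‖)) ^ r * (‖M p.1‖ * ‖M' p.2‖) := by
            gcongr
            · exact one_add_norm_add_le _ _
            · exact norm_mul_le _ _
        _ = _ := by rw [mul_pow]; ring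
    · simp only [← torusOp_mul_torusOp]
      have h0 := hM 0
      have h0' := hM' 0
      simp only [pow_zero, one_mul] at h0 h0'
      have h1 := summable_norm_torusOp Θ (g := g) h0
      have h2 := summable_norm_torusOp Θ (g := g') h0'
      have h3 := tsum_mul_tsum_of_summable_norm h1 h2
      rw [hT.tsum_eq, hT'.tsum_eq] at h3
      rw [h3]
      exact (summable_mul_of_summable_norm h1 h2).hasSum
  add_mem' := by
    rintro T T' ⟨ι, g, M, hg, hM, hT⟩ ⟨ι', g', M', hg', hM', hT'⟩
    refine ⟨ι ⊕ ι', Sum.elim g g', Sum.elim M M', ?_, fun r => ?_, ?_⟩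
    · rintro (i | i)
      · exact hg i
      · exact hg' i
    · exact (HasSum.sum (f := fun i => (1 + ‖Sum.elim g g' i‖) ^ r * ‖Sum.elim M M' i‖)
        (hM r).hasSum (hM' r).hasSum).summable
    · exact HasSum.sum (f := fun i => torusOp Θ (Sum.elim g g' i) (Sum.elim M M' i)) hT hT'
  algebraMap_mem' c := by
    refine ⟨Unit, fun _ => 0, fun _ => c • 1, fun _ => H.zero_mem, fun r => (hasSum_fintype _).summable, ?_⟩
    have : torusOp Θ 0 (c • 1) = algebraMap ℂ (Hil n →L[ℂ] Hil n) c := by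
      ext ψ : 1
      ext1; funext k
      rw [torusOp_apply]
      simp [pairing, Algebra.algebraMap_eq_smul_one]
    rw [← this]
    exact hasSum_unique _

theorem smoothAlg_mono {n : ℕ} (Θ : Matrix (Fin n) (Fin n) ℝ)
    {H K : AddSubgroup (Mode n × Mode n)} (h : H ≤ K) : smoothAlg Θ H ≤ smoothAlg Θ K :=
  fun _ ⟨ι, g, M, hg, hM, hT⟩ => ⟨ι, g, M, fun i => h (hg i), hM, hT⟩

/-- The frequencies of left multiplications. -/
def leftModes (n : ℕ) : AddSubgroup (Mode n × Mode n) := (AddMonoidHom.snd (Mode n) (Mode n)).ker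

/-- The frequencies of right multiplications. -/
def rightModes (n : ℕ) : AddSubgroup (Mode n × Mode n) := (AddMonoidHom.fst (Mode n) (Mode n)).ker

theorem conjJ_mem_smoothAlg {n : ℕ} {Θ : Matrix (Fin n) (Fin n) ℝ} (S : SpinStructure n)
    {T : Hil n →L[ℂ] Hil n} (hT : T ∈ smoothAlg Θ (leftModes n)) :
    conjJ S T ∈ smoothAlg Θ (rightModes n) := by
  obtain ⟨ι, g, M, hg, hM, hT⟩ := hT
  have hM' : ∀ r : ℕ, Summable fun i => (1 + ‖(-(g i).2, -(g i).1)‖) ^ r * ‖conjC0 S (M i)‖ := by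
    refine fun r => Summable.of_nonneg_of_le (fun p => by positivity) (fun i => ?_) (hM r)
    have : ‖(-(g i).2, -(g i).1)‖ = ‖g i‖ := by
      rw [Prod.norm_def, Prod.norm_def, norm_neg, norm_neg, max_comm]
    rw [this]
    exact mul_le_mul_of_nonneg_left (norm_conjC0_le S _) (by positivity)
  refine ⟨ι, fun i => (-(g i).2, -(g i).1), fun i => conjC0 S (M i), fun i => ?_, hM', ?_⟩
  · have : (g i).2 = 0 := hg i
    change -(g i).2 = 0
    rw [this, neg_zero]
  · have h0 := hM' 0
    simp only [pow_zero, one_mul] at h0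
    have h1 := (summable_norm_torusOp Θ (g := fun i => (-(g i).2, -(g i).1)) h0).of_norm.hasSum
    -- The series of conjugates converges in norm by the coefficient bounds; its sum is identified
    -- vector by vector, by applying `J` to the series for `T` evaluated at `J⁻¹ ψ`.
    convert! h1
    ext ψ : 1
    have h2 := (hT.mapL (ContinuousLinearMap.apply ℂ (Hil n) (realJInv S ψ))).mapL (realJ S)
    have h3 := h1.mapL (ContinuousLinearMap.apply ℂ (Hil n) ψ)
    simp only [← conjJ_torusOp] at h3 ⊢
    exact h2.unique h3

/-! ### Left multiplications, commutators and one-forms as smooth operators. -/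

theorem norm_le_modeNorm {n : ℕ} (k : Mode n) : ‖k‖ ≤ modeNorm k :=
  (pi_norm_le_iff_of_nonneg (modeNorm_nonneg k)).mpr fun i => by
    rw [Int.norm_eq_abs]; exact abs_le_modeNorm k i

theorem IsSchwartz.summable_weighted {n : ℕ} {a : Mode n → ℂ} (ha : IsSchwartz a) (r : ℕ) :
    Summable fun l => (1 + modeNorm l ^ 2) ^ r * ‖a l‖ := by
  have h : IsSchwartz fun l => (((1 + modeNorm l ^ 2) ^ r : ℝ) : ℂ) * a l := fun t => by
    obtain ⟨C, hC⟩ := ha (t + 2 * r)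
    refine ⟨C, fun k => le_trans (le_of_eq ?_) (hC k)⟩
    rw [norm_mul, Complex.norm_real, Real.norm_of_nonneg (by positivity)]
    ring
  refine h.summable_norm.congr fun l => ?_
  rw [norm_mul, Complex.norm_real, Real.norm_of_nonneg (by positivity)]

/-- The spare factor `1 + |l|^2` leaves room for the linear growth of `slash S l`, so that `L(a) ⊗
M` and `[𝒟, L(a)]` are covered by one estimate. -/
theorem IsSchwartz.summable_weighted_of_norm_le {n : ℕ} {a : Mode n → ℂ} (ha : IsSchwartz a)
    {M : Mode n → Spinor n →L[ℂ] Spinor n} {K : ℝ}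
    (hM : ∀ l, ‖M l‖ ≤ K * ((1 + modeNorm l ^ 2) * ‖a l‖)) (r : ℕ) :
    Summable fun l => (1 + ‖((l, 0) : Mode n × Mode n)‖) ^ r * ‖M l‖ := by
  refine Summable.of_nonneg_of_le (fun p => by positivity) (fun l => ?_)
    ((ha.summable_weighted (r + 1)).mul_left (2 ^ r * K))
  have h1 : ‖((l, 0) : Mode n × Mode n)‖ = ‖l‖ := by simp [Prod.norm_def]
  have h2 : 1 + ‖l‖ ≤ 2 * (1 + modeNorm l ^ 2) := by nlinarith [norm_le_modeNorm l, sq_nonneg (modeNorm l - 1)]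
  rw [h1]
  calc (1 + ‖l‖) ^ r * ‖M l‖
      ≤ (2 * (1 + modeNorm l ^ 2)) ^ r * (K * ((1 + modeNorm l ^ 2) * ‖a l‖)) :=
        mul_le_mul (pow_le_pow_left₀ (by positivity) h2 r) (hM l) (norm_nonneg _) (by positivity)
    _ = _ := by rw [mul_pow]; ring

theorem IsSchwartz.summable_norm_weyl {n : ℕ} (Θ : Matrix (Fin n) (Fin n) ℝ) {a : Mode n → ℂ}
    (ha : IsSchwartz a) {M : Mode n → Spinor n →L[ℂ] Spinor n} {K : ℝ}
    (hM : ∀ l, ‖M l‖ ≤ K * ((1 + modeNorm l ^ 2) * ‖a l‖)) :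
    Summable fun l => ‖weyl Θ l (M l)‖ := by
  have h0 := ha.summable_weighted_of_norm_le hM 0
  simp only [pow_zero, one_mul] at h0
  exact Summable.of_nonneg_of_le (fun _ => norm_nonneg _) (fun l => norm_weyl_le Θ l _) h0

theorem IsSchwartz.tsum_weyl_mem {n : ℕ} (Θ : Matrix (Fin n) (Fin n) ℝ) {a : Mode n → ℂ}
    (ha : IsSchwartz a) {M : Mode n → Spinor n →L[ℂ] Spinor n} {K : ℝ}
    (hM : ∀ l, ‖M l‖ ≤ K * ((1 + modeNorm l ^ 2) * ‖a l‖)) :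
    ∑' l, weyl Θ l (M l) ∈ smoothAlg Θ (leftModes n) := by
  refine ⟨Mode n, fun l => (l, 0),
    fun l => Complex.exp ((Complex.I / 2) * (pairing Θ l l : ℂ)) • M l, fun l => rfl, fun r => ?_, ?_⟩
  · simpa only [norm_smul, norm_exp_mul_ofReal_eq_one (c := Complex.I / 2) (by simp), one_mul]
      using ha.summable_weighted_of_norm_le hM r
  · simp only [← weyl_eq_torusOp]
    exact (ha.summable_norm_weyl Θ hM).of_norm.hasSum

theorem smul_weyl {n : ℕ} (Θ : Matrix (Fin n) (Fin n) ℝ) (c : ℂ) (l : Mode n)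
    (M : Spinor n →L[ℂ] Spinor n) : c • weyl Θ l M = weyl Θ l (c • M) := by
  rw [weyl_eq_torusOp, weyl_eq_torusOp, smul_torusOp, smul_comm]

theorem leftMul_eq {n : ℕ} (Θ : Matrix (Fin n) (Fin n) ℝ) (a : Mode n → ℂ)
    (M : Spinor n →L[ℂ] Spinor n) : leftMul Θ a M = ∑' l, weyl Θ l (a l • M) := by
  simp only [leftMul, smul_weyl]

theorem norm_smul_coeff_le {n : ℕ} (a : Mode n → ℂ) (M : Spinor n →L[ℂ] Spinor n) (l : Mode n) :
    ‖a l • M‖ ≤ ‖M‖ * ((1 + modeNorm l ^ 2) * ‖a l‖) := by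
  rw [norm_smul, mul_comm]
  refine mul_le_mul_of_nonneg_left ?_ (norm_nonneg _)
  exact le_mul_of_one_le_left (norm_nonneg _) (by nlinarith [sq_nonneg (modeNorm l)])

theorem IsSchwartz.leftMul_mem {n : ℕ} (Θ : Matrix (Fin n) (Fin n) ℝ) {a : Mode n → ℂ}
    (ha : IsSchwartz a) (M : Spinor n →L[ℂ] Spinor n) :
    leftMul Θ a M ∈ smoothAlg Θ (leftModes n) := by
  rw [leftMul_eq]
  exact ha.tsum_weyl_mem Θ (norm_smul_coeff_le a M)

theorem oneForm_mem {n : ℕ} (Θ : Matrix (Fin n) (Fin n) ℝ) (S : SpinStructure n)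
    {a : Fin n → Mode n → ℂ} (ha : ∀ α, IsSchwartz (a α)) :
    oneForm Θ S a ∈ smoothAlg Θ (leftModes n) :=
  Subalgebra.sum_mem _ fun α _ => Subalgebra.smul_mem _ ((ha α).leftMul_mem Θ _) _

theorem torusAlg_subset {n : ℕ} (Θ : Matrix (Fin n) (Fin n) ℝ) {T : Hil n →L[ℂ] Hil n}
    (hT : T ∈ torusAlg n Θ) : T ∈ smoothAlg Θ (leftModes n) := by
  obtain ⟨a, ha, rfl⟩ := hT
  exact ha.leftMul_mem Θ 1

/-- The matrix elements of an absolutely convergent series of Weyl operators. -/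
theorem tsum_weyl_single_apply {n : ℕ} (Θ : Matrix (Fin n) (Fin n) ℝ)
    {M : Mode n → Spinor n →L[ℂ] Spinor n} (hM : Summable fun l => ‖weyl Θ l (M l)‖)
    (k r : Mode n) (v : Spinor n) :
    (∑' l, weyl Θ l (M l)) (lp.single 2 k v) r =
      Complex.exp (-(Complex.I / 2) * (pairing Θ (r - k) k : ℂ)) • M (r - k) v := by
  have h1 := ((hM.of_norm.hasSum.mapL (ContinuousLinearMap.apply ℂ (Hil n)
    (lp.single 2 k v : Hil n))).mapL (lp.evalCLM ℂ (fun _ : Mode n => Spinor n) 2 r))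
  refine h1.unique ?_
  have h2 : (fun l => lp.evalCLM ℂ (fun _ : Mode n => Spinor n) 2 r
      (ContinuousLinearMap.apply ℂ (Hil n) (lp.single 2 k v : Hil n) (weyl Θ l (M l)))) =
      fun l => Complex.exp (-(Complex.I / 2) * (pairing Θ l (r - l) : ℂ)) •
        M l (Pi.single (M := fun _ => Spinor n) k v (r - l)) := rfl
  rw [h2]
  have h3 : HasSum (fun l => Complex.exp (-(Complex.I / 2) * (pairing Θ l (r - l) : ℂ)) •
      M l (Pi.single (M := fun _ => Spinor n) k v (r - l))) _ :=
    hasSum_single (r - k) fun l hl => ?_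
  · simpa only [sub_sub_cancel, Pi.single_eq_same] using h3
  · rw [Pi.single_eq_of_ne, map_zero, smul_zero]
    intro h
    exact hl (by rw [← h]; abel)

theorem norm_slash_le {n : ℕ} (S : SpinStructure n) (k : Mode n) :
    ‖slash S k‖ ≤ modeNorm k * ∑ μ, ‖S.gamma μ‖ := by
  rw [slash, Finset.mul_sum]
  refine norm_sum_le_of_le _ fun μ _ => ?_
  rw [norm_smul]
  refine mul_le_mul_of_nonneg_right ?_ (norm_nonneg _)
  simpa using abs_le_modeNorm k μ

theorem slash_sub {n : ℕ} (S : SpinStructure n) (k l : Mode n) :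
    slash S (k - l) = slash S k - slash S l := by
  simp [slash, sub_smul]

theorem single_mem_dirac_domain {n : ℕ} (S : SpinStructure n) (k : Mode n) (v : Spinor n) :
    (lp.single 2 k v : Hil n) ∈ (dirac S).domain ∧
      ∀ r, slash S r ((lp.single 2 k v : Hil n) r) = (lp.single 2 k (slash S k v) : Hil n) r := by
  have h : ∀ r, slash S r ((lp.single 2 k v : Hil n) r) =
      (lp.single 2 k (slash S k v) : Hil n) r := fun r => by
    by_cases hr : r = k
    · subst hr; simp
    · simp [Pi.single_eq_of_ne hr]
  refine ⟨?_, h⟩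
  change Memℓp (fun r => slash S r ((lp.single 2 k v : Hil n) r)) 2
  simp only [h]
  exact lp.memℓp _

/-- On each frequency, `[𝒟, L(U_l)] = L(U_l) ⊗ l_μ γ^μ`, because the symbol of `𝒟` is additive in
the mode. The factor of size `|l|` preserves rapid decay. -/
theorem diracComm_subset {n : ℕ} (Θ : Matrix (Fin n) (Fin n) ℝ) (S : SpinStructure n)
    {C : Hil n →L[ℂ] Hil n} (hC : C ∈ diracComm Θ S) : C ∈ smoothAlg Θ (leftModes n) := by
  obtain ⟨T, ⟨a, ha, rfl⟩, hC⟩ := hC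
  have hM : ∀ l, ‖a l • slash S l‖ ≤ (∑ μ, ‖S.gamma μ‖) * ((1 + modeNorm l ^ 2) * ‖a l‖) := by
    intro l
    have h0 : 0 ≤ ∑ μ, ‖S.gamma μ‖ := Finset.sum_nonneg fun _ _ => norm_nonneg _
    rw [norm_smul]
    calc ‖a l‖ * ‖slash S l‖ ≤ ‖a l‖ * ((1 + modeNorm l ^ 2) * ∑ μ, ‖S.gamma μ‖) := by
          refine mul_le_mul_of_nonneg_left ((norm_slash_le S l).trans ?_) (norm_nonneg _)
          refine mul_le_mul_of_nonneg_right ?_ h0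
          nlinarith [sq_nonneg (modeNorm l - 1)]
      _ = _ := by ring
  have hs := ha.summable_norm_weyl Θ hM
  have hsT := ha.summable_norm_weyl Θ (norm_smul_coeff_le a 1)
  have : C = ∑' l, weyl Θ l (a l • slash S l) := by
    -- Bounded operators are determined by their values on vectors supported at one mode, and these
    -- lie in the domain of `𝒟`, so the commutator can be evaluated on them.
    refine lp.ext_continuousLinearMap ENNReal.ofNat_ne_top fun k => ?_
    ext v : 1
    change C (lp.single 2 k v) = (∑' l, weyl Θ l (a l • slash S l)) (lp.single 2 k v)
    ext1; funext r
    rw [tsum_weyl_single_apply Θ hs]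
    obtain ⟨h1, h2⟩ := single_mem_dirac_domain S k v
    obtain ⟨h3, h4⟩ := hC ⟨_, h1⟩
    have h5 : dirac S ⟨_, h1⟩ = (lp.single 2 k (slash S k v) : Hil n) := by
      ext1; funext r; exact h2 r
    rw [← h4, h5]
    change slash S r (leftMul Θ a 1 (lp.single 2 k v) r) -
      leftMul Θ a 1 (lp.single 2 k (slash S k v)) r = _
    rw [leftMul_eq, tsum_weyl_single_apply Θ hsT, tsum_weyl_single_apply Θ hsT, slash_sub]
    simp only [smul_apply, one_apply_eq_self, map_smul, sub_apply, smul_sub]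
  rw [this]
  exact ha.tsum_weyl_mem Θ hM

theorem oneForms_le {n : ℕ} (Θ : Matrix (Fin n) (Fin n) ℝ) (S : SpinStructure n) :
    oneForms Θ S ≤ Subalgebra.toSubmodule (smoothAlg Θ (leftModes n)) := by
  refine Submodule.span_le.mpr ?_
  rintro _ ⟨T, hT, C, hC, rfl⟩
  exact Subalgebra.mul_mem _ (torusAlg_subset Θ hT) (diracComm_subset Θ S hC)

theorem bigAlg_le {n : ℕ} (Θ : Matrix (Fin n) (Fin n) ℝ) (S : SpinStructure n) :
    bigAlg Θ S ≤ smoothAlg Θ ⊤ := by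
  refine Algebra.adjoin_le ?_
  rintro T (((hT | hT) | ⟨T, hT, rfl⟩) | ⟨T, hT, rfl⟩)
  · exact smoothAlg_mono Θ le_top (torusAlg_subset Θ hT)
  · exact smoothAlg_mono Θ le_top (diracComm_subset Θ S hT)
  · exact smoothAlg_mono Θ le_top (conjJ_mem_smoothAlg S (torusAlg_subset Θ hT))
  · exact smoothAlg_mono Θ le_top (conjJ_mem_smoothAlg S (diracComm_subset Θ S hT))

/-! ## Diagonal blocks and small divisors -/

/-- For the frequencies `(l, -l)` in `H`, with `l ≠ 0`, one of the numbers `e^(-i l.Θe_j)` stays away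
from `1`, at a distance that is bounded below by a negative power of `1 + ‖l‖`. -/
def HasSmallDivisorBound {n : ℕ} (Θ : Matrix (Fin n) (Fin n) ℝ)
    (H : AddSubgroup (Mode n × Mode n)) : Prop :=
  ∃ η : ℝ, 0 < η ∧ ∃ D : ℕ, ∀ l : Mode n, l ≠ 0 → (l, -l) ∈ H → ∃ j,
    η ≤ (1 + ‖l‖) ^ D * ‖Complex.exp (-Complex.I * (pairing Θ l (unitMode j) : ℂ)) - 1‖

/-- Vacuous: `(l, -l)` has zero second component only for `l = 0`. This is why one-sided operators
need no arithmetic condition on `Θ`. -/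
theorem hasSmallDivisorBound_leftModes {n : ℕ} (Θ : Matrix (Fin n) (Fin n) ℝ) :
    HasSmallDivisorBound Θ (leftModes n) :=
  ⟨1, one_pos, 0, fun _ hl h => absurd (neg_eq_zero.mp h) hl⟩

theorem hasSmallDivisorBound_rightModes {n : ℕ} (Θ : Matrix (Fin n) (Fin n) ℝ) :
    HasSmallDivisorBound Θ (rightModes n) :=
  ⟨1, one_pos, 0, fun _ hl h => absurd h hl⟩

/-- By periodicity the right side is `2 |sin (π (x - round x))|`, and Jordan's inequality applies
since `|x - round x| ≤ 1/2`. -/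
theorem four_mul_abs_sub_round_le (x : ℝ) :
    4 * |x - round x| ≤ ‖Complex.exp (Complex.I * ((2 * Real.pi * x : ℝ) : ℂ)) - 1‖ := by
  have hper : Complex.exp (Complex.I * ((2 * Real.pi * x : ℝ) : ℂ)) =
      Complex.exp (Complex.I * ((2 * Real.pi * (x - round x) : ℝ) : ℂ)) := by
    rw [Complex.exp_eq_exp_iff_exists_int]
    refine ⟨round x, ?_⟩
    push_cast
    ring
  have hπ := Real.pi_pos
  rw [hper, Complex.norm_exp_I_mul_ofReal_sub_one, norm_mul, Real.norm_ofNat, Real.norm_eq_abs]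
  have h1 : 2 * Real.pi * (x - round x) / 2 = Real.pi * (x - round x) := by ring
  have h2 : |Real.pi * (x - round x)| = Real.pi * |x - round x| := by
    rw [abs_mul, abs_of_pos hπ]
  have h3 := Real.mul_abs_le_abs_sin (x := Real.pi * (x - round x)) (by
    rw [h2]; nlinarith [abs_sub_round x])
  rw [h1]
  rw [h2] at h3
  have h4 : 2 / Real.pi * (Real.pi * |x - round x|) = 2 * |x - round x| := by field_simp
  linarith

/-- Skew-symmetry turns the column of `Θ` that appears in the small divisor into the row that
appears in the Diophantine condition. -/
theorem pairing_unitMode {n : ℕ} {Θ : Matrix (Fin n) (Fin n) ℝ} (hΘ : Θ.transpose = -Θ)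
    (l : Mode n) (j : Fin n) :
    pairing Θ l (unitMode j) =
      -(2 * Real.pi * ((2 * Real.pi)⁻¹ • Θ).mulVec (fun i => (l i : ℝ)) j) := by
  have hπ := Real.pi_ne_zero
  have h : ∀ i, Θ i j = -Θ j i := fun i => by
    have := congrFun (congrFun hΘ j) i
    simpa using this
  rw [Matrix.smul_mulVec, Pi.smul_apply, smul_eq_mul, mul_inv_cancel_left₀ (by positivity)]
  simp only [pairing, Matrix.mulVec, dotProduct]
  rw [← Finset.sum_neg_distrib]
  refine Finset.sum_congr rfl fun i _ => ?_
  rw [Finset.sum_eq_single j]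
  · rw [show unitMode j j = 1 from Pi.single_eq_same j 1, h]; push_cast; ring
  · intro b _ hb; rw [show unitMode j b = 0 from Pi.single_eq_of_ne hb 1]; simp
  · simp

theorem modeNorm_le {n : ℕ} (k : Mode n) : modeNorm k ≤ n * ‖k‖ := by
  have h0 : (0 : ℝ) ≤ n * ‖k‖ := by positivity
  rw [← sq_le_sq₀ (modeNorm_nonneg k) h0, modeNorm_sq]
  calc ∑ i, (k i : ℝ) ^ 2 ≤ ∑ _i : Fin n, ‖k‖ ^ 2 := by
        refine Finset.sum_le_sum fun i _ => ?_
        have h := norm_le_pi_norm k i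
        rw [Int.norm_eq_abs] at h
        rw [← sq_abs]
        exact pow_le_pow_left₀ (abs_nonneg _) h 2
    _ = n * ‖k‖ ^ 2 := by simp
    _ ≤ (n * ‖k‖) ^ 2 := by
        rw [mul_pow]
        refine mul_le_mul_of_nonneg_right ?_ (by positivity)
        exact_mod_cast Nat.le_self_pow two_ne_zero n

/-- If all `n` divisors were too small, every coordinate of `Θ l / 2π` would be within `ε` of an
integer, and the distance to `ℤⁿ` would be at most `n ε`; but the Diophantine bound makes it at
least `(n + 1) ε`. -/
theorem IsDiophantine.hasSmallDivisorBound {n : ℕ} {Θ : Matrix (Fin n) (Fin n) ℝ}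
    (hΘ : Θ.transpose = -Θ) (h : IsDiophantine ((2 * Real.pi)⁻¹ • Θ)) :
    HasSmallDivisorBound Θ ⊤ := by
  obtain ⟨δ, hδ, c, hc, h⟩ := h
  obtain ⟨D, hD⟩ := exists_nat_gt δ
  have hn1 : (0 : ℝ) < n + 1 := by positivity
  -- The `4` comes from Jordan's inequality, `(n + 1)^D` from comparing the Euclidean and sup norms
  -- of `l`, and the last `n + 1` from passing from the distance vector to its coordinates.
  refine ⟨4 * (c / ((n + 1) ^ D * (n + 1))), by positivity, D, fun l hl _ => ?_⟩
  set x : Fin n → ℝ := ((2 * Real.pi)⁻¹ • Θ).mulVec (fun i => (l i : ℝ)) with hx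
  have h1 := h l hl fun i => round (x i)
  have hexp : ∀ j, 4 * |x j - round (x j)| ≤
      ‖Complex.exp (-Complex.I * (pairing Θ l (unitMode j) : ℂ)) - 1‖ := fun j => by
    refine (four_mul_abs_sub_round_le (x j)).trans_eq ?_
    rw [pairing_unitMode hΘ]
    congr 3
    push_cast
    ring
  have hl1 := one_le_modeNorm hl
  have hlow : c / ((n + 1) ^ D * (1 + ‖l‖) ^ D) ≤ c * modeNorm l ^ (-δ) := by
    rw [div_eq_mul_inv]
    refine mul_le_mul_of_nonneg_left ?_ hc.le
    rw [Real.rpow_neg (by positivity)]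
    refine inv_anti₀ (by positivity) ?_
    rw [← mul_pow, ← Real.rpow_natCast]
    calc modeNorm l ^ δ ≤ modeNorm l ^ (D : ℝ) := Real.rpow_le_rpow_of_exponent_le hl1 hD.le
      _ ≤ _ := by
        refine Real.rpow_le_rpow (by positivity) ((modeNorm_le l).trans ?_) (by positivity)
        nlinarith [norm_nonneg l]
  by_contra hcon
  push Not at hcon
  set ε : ℝ := c / ((n + 1) ^ D * (n + 1) * (1 + ‖l‖) ^ D) with hε
  have hεpos : 0 < ε := by positivity
  have hsmall : ∀ j, |x j - round (x j)| ≤ ε := fun j => by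
    have h2 := hcon j
    have hp : 0 < (1 + ‖l‖) ^ D := by positivity
    have h3 : (1 + ‖l‖) ^ D * (4 * |x j - round (x j)|) < 4 * (c / ((n + 1) ^ D * (n + 1))) :=
      (mul_le_mul_of_nonneg_left (hexp j) hp.le).trans_lt h2
    rw [hε, ← div_div, le_div_iff₀ hp]
    linarith
  have h4 : Real.sqrt (∑ i, (x i - ((round (x i) : ℤ) : ℝ)) ^ 2) ≤ n * ε := by
    refine Real.sqrt_le_iff.mpr ⟨by positivity, ?_⟩
    calc ∑ i, (x i - ((round (x i) : ℤ) : ℝ)) ^ 2 ≤ ∑ _i : Fin n, ε ^ 2 :=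
          Finset.sum_le_sum fun i _ => by
            rw [← sq_abs]; exact pow_le_pow_left₀ (abs_nonneg _) (hsmall i) 2
      _ = n * ε ^ 2 := by simp
      _ ≤ (n * ε) ^ 2 := by
          rw [mul_pow]
          refine mul_le_mul_of_nonneg_right ?_ (by positivity)
          exact_mod_cast Nat.le_self_pow two_ne_zero n
  have h5 : (n + 1) * ε = c / ((n + 1) ^ D * (1 + ‖l‖) ^ D) := by
    rw [hε]; field_simp
  have h6 := hlow.trans (h1.trans h4)
  rw [← h5] at h6
  linarith

/-- The partial trace `∑ⱼ ⟨U_k ⊗ e_j, T (U_k ⊗ X e_j)⟩` of `T (1 ⊗ X)` over the spinors. -/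
def diagWeight {n : ℕ} (T : Hil n →L[ℂ] Hil n) (X : Spinor n →L[ℂ] Spinor n) (k : Mode n) : ℂ :=
  ∑ j, inner ℂ (spinorBasis n j) (T (lp.single 2 k (X (spinorBasis n j))) k)

theorem diagWeight_smul {n : ℕ} (T : Hil n →L[ℂ] Hil n) (c : ℂ) (X : Spinor n →L[ℂ] Spinor n)
    (k : Mode n) : diagWeight T (c • X) k = c * diagWeight T X k := by
  simp only [diagWeight, Finset.mul_sum]
  refine Finset.sum_congr rfl fun j _ => ?_
  rw [smul_apply, lp.single_smul, map_smul, lp.coeFn_smul, Pi.smul_apply, inner_smul_right]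

theorem diagWeight_sum {n : ℕ} {κ : Type*} (s : Finset κ) (T : Hil n →L[ℂ] Hil n)
    (X : κ → Spinor n →L[ℂ] Spinor n) (k : Mode n) :
    diagWeight T (∑ μ ∈ s, X μ) k = ∑ μ ∈ s, diagWeight T (X μ) k := by
  classical
  induction s using Finset.induction_on with
  | empty => simp [diagWeight]
  | insert a s ha ih =>
    rw [Finset.sum_insert ha, Finset.sum_insert ha, ← ih]
    simp only [diagWeight, ← Finset.sum_add_distrib]
    refine Finset.sum_congr rfl fun j _ => ?_
    rw [add_apply, lp.single_add, map_add, lp.coeFn_add, Pi.add_apply, inner_add_right]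

/-- The operator shifts modes by `l + m`, so its diagonal vanishes unless `m = -l`; then `l - m =
2l` doubles the half phase into the character `e^(-i l.Θk)`. -/
theorem diagWeight_torusOp {n : ℕ} (Θ : Matrix (Fin n) (Fin n) ℝ) (g : Mode n × Mode n)
    (M X : Spinor n →L[ℂ] Spinor n) (k : Mode n) :
    diagWeight (torusOp Θ g M) X k =
      (if g.1 + g.2 = 0 then ∑ j, inner ℂ (spinorBasis n j) (M (X (spinorBasis n j))) else 0) *
        Complex.exp (-Complex.I * (pairing Θ g.1 k : ℂ)) := by
  unfold diagWeight
  simp only [torusOp_apply, lp.single_apply, inner_smul_right, ← Finset.mul_sum]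
  split_ifs with h
  · have h1 : g.1 - g.2 = g.1 + g.1 := by rw [eq_neg_of_add_eq_zero_right h, sub_neg_eq_add]
    simp only [h, sub_zero, Pi.single_eq_same, h1, pairing_add_left]
    rw [mul_comm]
    congr 2
    push_cast
    ring
  · rw [zero_mul]
    refine mul_eq_zero_of_right _ (Finset.sum_eq_zero fun j _ => ?_)
    rw [Pi.single_eq_of_ne, map_zero, inner_zero_right]
    intro hk
    exact h (by simpa using hk)

theorem hasSum_diagWeight {n : ℕ} {ι : Type*} {f : ι → Hil n →L[ℂ] Hil n} {T : Hil n →L[ℂ] Hil n}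
    (hf : HasSum f T) (X : Spinor n →L[ℂ] Spinor n) (k : Mode n) :
    HasSum (fun t => diagWeight (f t) X k) (diagWeight T X k) := by
  refine hasSum_sum fun j _ => ?_
  exact ((hf.mapL (ContinuousLinearMap.apply ℂ (Hil n)
    (lp.single 2 k (X (spinorBasis n j)) : Hil n))).mapL
      (lp.evalCLM ℂ (fun _ : Mode n => Spinor n) 2 k)).mapL (innerSL ℂ (spinorBasis n j))

theorem norm_sum_inner_le {n : ℕ} (M X : Spinor n →L[ℂ] Spinor n) :
    ‖∑ j, inner ℂ (spinorBasis n j) (M (X (spinorBasis n j)))‖ ≤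
      (∑ _j : Fin (2 ^ (n / 2)), ‖X‖) * ‖M‖ := by
  rw [Finset.sum_mul]
  refine norm_sum_le_of_le _ fun j _ => ?_
  have h1 : ‖spinorBasis n j‖ = 1 := (spinorBasis n).orthonormal.1 j
  refine (norm_inner_le_norm _ _).trans ?_
  rw [h1, one_mul, mul_comm]
  refine (M.le_opNorm _).trans (mul_le_mul_of_nonneg_left ?_ (norm_nonneg _))
  simpa [h1] using X.le_opNorm (spinorBasis n j)

/-- The diagonal blocks of a smooth operator are, as functions of the mode, constants up to a
difference-exact function. -/
theorem exists_isDiffExact_diagWeight {n : ℕ} (hn : 0 < n) {Θ : Matrix (Fin n) (Fin n) ℝ}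
    {H : AddSubgroup (Mode n × Mode n)} (hH : HasSmallDivisorBound Θ H) {T : Hil n →L[ℂ] Hil n}
    (hT : T ∈ smoothAlg Θ H) (X : Spinor n →L[ℂ] Spinor n) :
    ∃ c : ℂ, IsDiffExact fun k => diagWeight T X k - c := by
  classical
  obtain ⟨η, hη, D, hD⟩ := hH
  obtain ⟨ι, g, M, hg, hM, hT⟩ := hT
  set K : ℝ := ∑ _j : Fin (2 ^ (n / 2)), ‖X‖ with hK
  have hK0 : 0 ≤ K := Finset.sum_nonneg fun _ _ => norm_nonneg _
  set b : ι → ℂ := fun t => if (g t).1 + (g t).2 = 0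
    then ∑ j, inner ℂ (spinorBasis n j) (M t (X (spinorBasis n j))) else 0 with hb
  have hbM : ∀ t, ‖b t‖ ≤ K * ‖M t‖ := fun t => by
    simp only [hb]
    split_ifs
    · exact norm_sum_inner_le (M t) X
    · rw [norm_zero]; positivity
  set χ : ι → Mode n → ℂ := fun t k => Complex.exp (-Complex.I * (pairing Θ (g t).1 k : ℂ)) with hχ
  have hχ1 : ∀ t k, ‖χ t k‖ = 1 := fun t k => norm_exp_mul_ofReal_eq_one (by simp) _
  set c : ι → ℂ := fun t => if (g t).1 = 0 then 0 else b t with hc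
  have hcb : ∀ t, ‖c t‖ ≤ K * ‖M t‖ := fun t => by
    simp only [hc]
    split_ifs
    · rw [norm_zero]; positivity
    · exact hbM t
  have hM0 : Summable fun t => K * ‖M t‖ := by simpa using (hM 0).mul_left K
  -- The terms with trivial character, whose sum is the constant; the remaining terms on the
  -- diagonal have `l ≠ 0`.
  set c₀ : ι → ℂ := fun t => if (g t).1 = 0 then b t else 0 with hc₀
  have hc₀s : Summable c₀ := Summable.of_norm_bounded hM0 fun t => by
    simp only [hc₀]
    split_ifs
    · exact hbM t
    · rw [norm_zero]; positivity
  refine ⟨∑' t, c₀ t, ?_⟩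
  have hw : (fun k => diagWeight T X k - ∑' t, c₀ t) = fun k => ∑' t, c t * χ t k := by
    funext k
    have h1 := hasSum_diagWeight hT X k
    simp only [diagWeight_torusOp] at h1
    have h2 := (h1.sub hc₀s.hasSum).tsum_eq
    rw [← h2]
    refine tsum_congr fun t => ?_
    change b t * χ t k - c₀ t = c t * χ t k
    simp only [hc, hc₀]
    split_ifs with h0
    · have : χ t k = 1 := by simp [hχ, h0, pairing]
      rw [this]; ring
    · ring
  rw [hw]
  have hex : ∀ t, ∃ j, c t ≠ 0 → η ≤ (1 + ‖g t‖) ^ D * ‖χ t (unitMode j) - 1‖ := by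
    intro t
    by_cases h0 : c t = 0
    · exact ⟨⟨0, hn⟩, fun h => absurd h0 h⟩
    · have h1 : (g t).1 ≠ 0 := fun h => h0 (by simp only [hc, h, if_true])
      have h2 : (g t).1 + (g t).2 = 0 := by
        by_contra h
        exact h0 (by simp only [hc, hb, h, if_false, ite_self])
      have h3 : g t = ((g t).1, -(g t).1) := Prod.ext rfl (eq_neg_of_add_eq_zero_right h2)
      obtain ⟨j, hj⟩ := hD (g t).1 h1 (h3 ▸ hg t)
      refine ⟨j, fun _ => hj.trans ?_⟩
      refine mul_le_mul_of_nonneg_right (pow_le_pow_left₀ (by positivity) ?_ D) (norm_nonneg _)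
      linarith [norm_fst_le (g t)]
  choose j hj using hex
  refine isDiffExact_tsum (z := fun t i => χ t (unitMode i)) (fun t i k => ?_)
    (fun t k => (hχ1 t k).le) (fun t i => (hχ1 t _).le) j (fun t ht h1 => ?_) (fun N => ?_)
  · simp only [hχ, pairing_add_right, ← Complex.exp_add]
    congr 1
    push_cast
    ring
  · have := hj t ht
    rw [h1, sub_self, norm_zero, mul_zero] at this
    linarith
  -- The `N`-th power of the inverse divisor grows at most like `(1 + ‖g t‖)^(D N)`, which the decay
  -- of `M` absorbs.
  · refine Summable.of_nonneg_of_le (fun _ => norm_nonneg _) (fun t => ?_)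
      ((hM (D * N)).mul_left (η⁻¹ ^ N * K))
    by_cases h0 : c t = 0
    · rw [h0, mul_zero, norm_zero]; positivity
    · have h1 := hj t h0
      have hd : 0 < ‖χ t (unitMode (j t)) - 1‖ := by
        rcases (norm_nonneg (χ t (unitMode (j t)) - 1)).eq_or_lt with h | h
        · rw [← h, mul_zero] at h1; linarith
        · exact h
      have h2 : ‖χ t (unitMode (j t)) - 1‖⁻¹ ≤ η⁻¹ * (1 + ‖g t‖) ^ D := by
        rw [inv_le_iff_one_le_mul₀ hd, mul_assoc, ← div_eq_inv_mul, one_le_div hη]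
        exact h1
      rw [norm_mul, norm_inv, norm_pow, ← inv_pow]
      calc _ ≤ (η⁻¹ * (1 + ‖g t‖) ^ D) ^ N * (K * ‖M t‖) :=
            mul_le_mul (pow_le_pow_left₀ (by positivity) h2 N) (hcb t) (norm_nonneg _)
              (by positivity)
        _ = _ := by rw [mul_pow, ← pow_mul]; ring

/-! ## Traces and residues -/

theorem orthonormal_basisVec (n : ℕ) : Orthonormal ℂ (basisVec (n := n)) := by
  classical
  rw [orthonormal_iff_ite]
  rintro ⟨k, i⟩ ⟨l, j⟩
  rw [basisVec, basisVec, lp.inner_single_left, lp.single_apply]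
  by_cases hkl : k = l
  · subst hkl
    simp [(orthonormal_iff_ite.mp (spinorBasis n).orthonormal) i j]
  · rw [Pi.single_eq_of_ne hkl, inner_zero_right, if_neg]
    exact fun h => hkl (congrArg Prod.fst h)

/-- The Hilbert basis `(U_k ⊗ e_j)`. -/
def hilBasis (n : ℕ) : HilbertBasis (Mode n × Fin (2 ^ (n / 2))) ℂ (Hil n) :=
  HilbertBasis.mkOfOrthogonalEqBot (orthonormal_basisVec n) (by
    rw [Submodule.eq_bot_iff]
    intro ψ hψ
    ext1; funext k
    rw [← (spinorBasis n).sum_repr' (ψ k)]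
    refine Finset.sum_eq_zero fun j _ => ?_
    have := (Submodule.mem_orthogonal _ _).mp hψ (basisVec (k, j)) (Submodule.subset_span ⟨_, rfl⟩)
    rw [basisVec, lp.inner_single_left] at this
    rw [this, zero_smul])

theorem hasSum_basisVec {n : ℕ} (ψ : Hil n) :
    HasSum (fun p => (inner ℂ (basisVec p) ψ : ℂ) • basisVec p) ψ := by
  have h := (hilBasis n).hasSum_repr ψ
  have hb : ⇑(hilBasis n) = basisVec := HilbertBasis.coe_mkOfOrthogonalEqBot _ _
  simpa only [HilbertBasis.repr_apply_apply, hb] using h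

theorem norm_basisVec {n : ℕ} (p : Mode n × Fin (2 ^ (n / 2))) : ‖basisVec p‖ = 1 :=
  (orthonormal_basisVec n).1 p

/-- Expanding a vector in the basis writes `T` as the sum of the rank one operators `⟨e_p, ·⟩ T
e_p`. -/
theorem isTraceClass_of_summable {n : ℕ} {T : Hil n →L[ℂ] Hil n}
    (hT : Summable fun p => ‖T (basisVec p)‖) : IsTraceClass T := by
  refine ⟨_, fun p => T (basisVec p), basisVec, ?_, fun ψ => ?_⟩
  · simpa only [norm_basisVec, mul_one] using hT
  · simpa only [map_smul] using (hasSum_basisVec ψ).mapL T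

/-- The eigenvalue of `|D|^(-s)` on `U_k ⊗ ℂ^(2^m)`. -/
def absSymbol {n : ℕ} (s : ℂ) (k : Mode n) : ℂ :=
  if k = 0 then 1 else (modeNorm k : ℂ) ^ (-s)

theorem blockOp_refl_single {n : ℕ} (M : Mode n → Spinor n →L[ℂ] Spinor n) (C : ℝ)
    (hM : ∀ k v, ‖M k v‖ ≤ C * ‖v‖) (k : Mode n) (v : Spinor n) :
    blockOp (Equiv.refl _) M C hM (lp.single 2 k v) = lp.single 2 k (M k v) := by
  ext1; funext r
  rw [blockOp_apply, Equiv.refl_apply, lp.single_apply, lp.single_apply]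
  by_cases h : r = k
  · subst h; simp
  · rw [Pi.single_eq_of_ne h, Pi.single_eq_of_ne h, map_zero]

theorem absDiracPow_single {n : ℕ} (s : ℂ) (hs : 0 ≤ s.re) (k : Mode n) (v : Spinor n) :
    absDiracPow n s hs (lp.single 2 k v) = absSymbol s k • (lp.single 2 k v : Hil n) := by
  rw [absDiracPow, blockOp_refl_single, ← lp.single_smul]
  rfl

theorem diracInv_pow_single {n : ℕ} (S : SpinStructure n) (q : ℕ) (k : Mode n) (v : Spinor n) :
    (diracInv S ^ q) (lp.single 2 k v) = lp.single 2 k ((diracInvSymbol S k ^ q) v) := by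
  induction q with
  | zero => rfl
  | succ q ih =>
    rw [pow_succ', pow_succ', mul_apply_eq_comp, ih, diracInv, blockOp_refl_single,
      mul_apply_eq_comp]

theorem summable_norm_absSymbol {n : ℕ} {s : ℂ} (hs : 2 * n ≤ s.re) :
    Summable fun k : Mode n => ‖absSymbol s k‖ := by
  refine (summable_congr_cofinite ?_).mpr
    (summable_modeNorm_rpow (n := n) (r := -s.re) (by linarith))
  rw [Filter.EventuallyEq, Filter.eventually_cofinite]
  refine (Set.finite_singleton (0 : Mode n)).subset fun k hk => ?_
  by_contra h0
  have h0 : k ≠ 0 := h0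
  refine hk ?_
  rw [absSymbol, if_neg h0, Complex.norm_cpow_eq_rpow_re_of_pos (modeNorm_pos h0), Complex.neg_re]

theorem summable_norm_mul_absDiracPow {n : ℕ} (B : Hil n →L[ℂ] Hil n) {s : ℂ} (hs : 0 ≤ s.re)
    (hs' : 2 * n ≤ s.re) : Summable fun p => ‖(B * absDiracPow n s hs) (basisVec p)‖ := by
  have h1 : Summable fun p : Mode n × Fin (2 ^ (n / 2)) => ‖absSymbol s p.1‖ * (1 : ℝ) :=
    (summable_norm_absSymbol hs').mul_of_nonneg (hasSum_fintype _).summable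
      (fun _ => norm_nonneg _) (fun _ => zero_le_one)
  refine Summable.of_nonneg_of_le (fun _ => norm_nonneg _) (fun p => ?_) (h1.mul_left ‖B‖)
  rw [mul_apply_eq_comp, basisVec, absDiracPow_single, map_smul, norm_smul, mul_one, mul_comm]
  refine mul_le_mul_of_nonneg_right ?_ (norm_nonneg _)
  exact (B.le_opNorm _).trans_eq (by rw [← basisVec, norm_basisVec, mul_one])

theorem opTrace_eq_tsum {n : ℕ} (S : SpinStructure n) (T : Hil n →L[ℂ] Hil n) (q : ℕ) {s : ℂ}
    (hs : 0 ≤ s.re) (hs' : 2 * n ≤ s.re) :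
    opTrace (T * diracInv S ^ q * absDiracPow n s hs) =
      ∑' k : Mode n, absSymbol s k * diagWeight T (diracInvSymbol S k ^ q) k := by
  have h := summable_norm_mul_absDiracPow (T * diracInv S ^ q) hs hs'
  have h1 : Summable fun p : Mode n × Fin (2 ^ (n / 2)) =>
      (inner ℂ (basisVec p) ((T * diracInv S ^ q * absDiracPow n s hs) (basisVec p)) : ℂ) :=
    Summable.of_norm_bounded h fun p => by
      simpa only [norm_basisVec, one_mul] using norm_inner_le_norm (𝕜 := ℂ) (basisVec p)
        ((T * diracInv S ^ q * absDiracPow n s hs) (basisVec p))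
  rw [opTrace, h1.tsum_prod]
  refine tsum_congr fun k => ?_
  rw [tsum_fintype, diagWeight, Finset.mul_sum]
  refine Finset.sum_congr rfl fun j _ => ?_
  rw [mul_apply_eq_comp, mul_apply_eq_comp, basisVec, absDiracPow_single, map_smul, map_smul,
    diracInv_pow_single, lp.inner_single_left, lp.coeFn_smul, Pi.smul_apply, inner_smul_right]

theorem diracInvSymbol_sq {n : ℕ} (S : SpinStructure n) {k : Mode n} (hk : k ≠ 0) :
    diracInvSymbol S k ^ 2 = ((modeNorm k : ℂ) ^ 2)⁻¹ • (1 : Spinor n →L[ℂ] Spinor n) := by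
  have h1 : (modeNorm k : ℂ) ≠ 0 := by exact_mod_cast (modeNorm_pos hk).ne'
  rw [diracInvSymbol, if_neg hk, pow_two, smul_mul_smul_comm, slash_sq, smul_smul]
  congr 1
  push_cast
  field_simp

theorem absSymbol_mul_diagWeight_even {n : ℕ} (S : SpinStructure n) (T : Hil n →L[ℂ] Hil n)
    (μ : Fin n) (r : ℕ) (s : ℂ) {k : Mode n} (hk : k ≠ 0) :
    absSymbol s k * diagWeight T (diracInvSymbol S k ^ (2 * r)) k =
      diagWeight T 1 k * latticeTerm μ 0 (s + (2 * r : ℕ)) k := by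
  have h1 : (modeNorm k : ℂ) ≠ 0 := by exact_mod_cast (modeNorm_pos hk).ne'
  rw [pow_mul, diracInvSymbol_sq S hk, smul_pow, one_pow, diagWeight_smul, absSymbol, if_neg hk,
    latticeTerm, if_neg hk, neg_add, Complex.cpow_add _ _ h1, Complex.cpow_neg _ ((2 * r : ℕ) : ℂ),
    Complex.cpow_natCast, pow_mul, inv_pow]
  ring

/-- One factor `k_μ γ^μ` survives the Clifford relation: `γ^μ` goes into the weight, `k_μ` raises
the degree `d` to `1`, and the exponent becomes `q + 1`. -/
theorem absSymbol_mul_diagWeight_odd {n : ℕ} (S : SpinStructure n) (T : Hil n →L[ℂ] Hil n)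
    (r : ℕ) (s : ℂ) {k : Mode n} (hk : k ≠ 0) :
    absSymbol s k * diagWeight T (diracInvSymbol S k ^ (2 * r + 1)) k =
      ∑ μ, diagWeight T (S.gamma μ) k * latticeTerm μ 1 (s + (2 * (r + 1) : ℕ)) k := by
  have h1 : (modeNorm k : ℂ) ≠ 0 := by exact_mod_cast (modeNorm_pos hk).ne'
  have h2 : diracInvSymbol S k ^ (2 * r + 1) =
      (((modeNorm k : ℂ) ^ (2 * (r + 1)))⁻¹) • slash S k := by
    rw [pow_succ, pow_mul, diracInvSymbol_sq S hk, smul_pow, one_pow, smul_mul_assoc, one_mul,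
      diracInvSymbol, if_neg hk, smul_smul]
    congr 1
    push_cast
    rw [← pow_succ, inv_pow, ← pow_mul]
  rw [h2, diagWeight_smul, slash, diagWeight_sum, Finset.mul_sum, Finset.mul_sum]
  refine Finset.sum_congr rfl fun μ _ => ?_
  rw [diagWeight_smul, absSymbol, if_neg hk,
    latticeTerm, if_neg hk, neg_add, Complex.cpow_add _ _ h1,
    Complex.cpow_neg _ ((2 * (r + 1) : ℕ) : ℂ), Complex.cpow_natCast]
  ring

/-- Cauchy's theorem on circles inside the domain of analyticity. -/
theorem hasResidue_zero_of_analyticAt {F : ℂ → ℂ} {z₀ : ℂ} (hF : AnalyticAt ℂ F z₀) :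
    HasResidue F z₀ 0 := by
  obtain ⟨ε, hε, hball⟩ := Metric.eventually_nhds_iff_ball.mp hF.eventually_analyticAt
  filter_upwards [Ioo_mem_nhdsGT hε] with r hr
  have hd : DifferentiableOn ℂ F (Metric.closedBall z₀ r) := fun z hz =>
    (hball z (Metric.closedBall_subset_ball hr.2 hz)).differentiableAt.differentiableWithinAt
  rw [DiffContOnCl.circleIntegral_eq_zero hr.1.le (hd.diffContOnCl_ball subset_rfl), mul_zero]

/-- A sum that, away from the mode `0`, consists of finitely many lattice zeta series with weights
that are constant up to difference-exact functions, extends to a meromorphic function that is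
analytic at the origin. -/
theorem exists_extension_of_eq_sum {n : ℕ} {κ : Type*} (I : Finset κ) (f : ℂ → Mode n → ℂ) (a : ℂ)
    (hf0 : ∀ s, f s 0 = a) (w : κ → Mode n → ℂ) (hw : ∀ i, ∃ c, IsDiffExact fun k => w i k - c)
    (μ : κ → Fin n) (d q : ℕ) (hq : q ≠ n + d)
    (hf : ∀ s k, k ≠ 0 → f s k = ∑ i ∈ I, w i k * latticeTerm (μ i) d (s + q) k) :
    ∃ F : ℂ → ℂ, Meromorphic F ∧ AnalyticAt ℂ F 0 ∧
      ∀ s : ℂ, 2 * n + d ≤ s.re → HasSum (f s) (F s) := by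
  choose c hc using hw
  choose G hGm hGa hGs using fun i => exists_meromorphic_extension (hc i) (μ i) d
  refine ⟨fun s => a + ∑ i ∈ I, G i (s + q), fun s => ?_, ?_, fun s hs => ?_⟩
  · refine (MeromorphicAt.const a s).add (MeromorphicAt.fun_sum fun i _ => ?_)
    exact (hGm i (s + q)).comp_analyticAt (g := fun s : ℂ => s + q) (by fun_prop)
  · refine analyticAt_const.add (Finset.analyticAt_fun_sum _ fun i _ => ?_)
    have h1 : AnalyticAt ℂ (G i) ((0 : ℂ) + q) := by
      have := hGa i q (by exact_mod_cast hq)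
      simpa using this
    exact AnalyticAt.fun_comp (f := fun s : ℂ => s + q) h1 (by fun_prop)
  · have h1 : HasSum (fun k : Mode n => if k = 0 then a else 0) a := hasSum_ite_eq 0 a
    have h2 : HasSum (fun k => ∑ i ∈ I, w i k * latticeTerm (μ i) d (s + q) k)
        (∑ i ∈ I, G i (s + q)) := hasSum_sum fun i _ => hGs i (s + q) (by
      rw [Complex.add_re, Complex.natCast_re]
      have : (0 : ℝ) ≤ q := q.cast_nonneg
      linarith)
    refine (h1.add h2).congr_fun fun k => ?_
    by_cases hk : k = 0
    · subst hk; simp [hf0, latticeTerm]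
    · rw [hf s k hk, if_neg hk, zero_add]

/-- The noncommutative integral of `T D^(-q)` vanishes for `1 ≤ q < n` if `T` is a smooth operator
whose frequencies satisfy a small divisor bound. -/
theorem hasNCIntegral_zero {n : ℕ} {Θ : Matrix (Fin n) (Fin n) ℝ} (S : SpinStructure n)
    {H : AddSubgroup (Mode n × Mode n)} (hH : HasSmallDivisorBound Θ H) {T : Hil n →L[ℂ] Hil n}
    (hT : T ∈ smoothAlg Θ H) {q : ℕ} (hqn : q < n) :
    HasNCIntegral (T * diracInv S ^ q) 0 := by
  have hn : 0 < n := by omega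
  have hw := exists_isDiffExact_diagWeight hn hH hT
  have key : ∃ (F : ℂ → ℂ) (d : ℕ), Meromorphic F ∧ AnalyticAt ℂ F 0 ∧ ∀ s : ℂ, 2 * n + d ≤ s.re →
      HasSum (fun k => absSymbol s k * diagWeight T (diracInvSymbol S k ^ q) k) (F s) := by
    -- At the mode `0` the operator `D` is the identity, so this mode contributes a constant
    -- independent of `s`.
    have h0 : ∀ s : ℂ, absSymbol s (0 : Mode n) * diagWeight T (diracInvSymbol S 0 ^ q) 0 =
        diagWeight T 1 0 := fun s => by simp [absSymbol, diracInvSymbol]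
    rcases Nat.even_or_odd' q with ⟨r, rfl | rfl⟩
    · obtain ⟨F, hF⟩ := exists_extension_of_eq_sum (Finset.univ : Finset Unit) _ _ h0
        (fun _ => diagWeight T 1) (fun _ => hw 1) (fun _ => ⟨0, hn⟩) 0 (2 * r) (by omega)
        (fun s k hk => by simpa using absSymbol_mul_diagWeight_even S T ⟨0, hn⟩ r s hk)
      exact ⟨F, 0, hF⟩
    -- The shift `2 (r + 1) = q + 1` meets the pole `n + d = n + 1` only if `q = n`.
    · obtain ⟨F, hF⟩ := exists_extension_of_eq_sum (Finset.univ : Finset (Fin n)) _ _ h0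
        (fun μ => diagWeight T (S.gamma μ)) (fun μ => hw (S.gamma μ)) (fun μ => μ) 1 (2 * (r + 1))
        (by omega) (fun s k hk => absSymbol_mul_diagWeight_odd S T r s hk)
      exact ⟨F, 1, hF⟩
  obtain ⟨F, d, hFm, hFa, hFs⟩ := key
  refine ⟨F, 2 * n + d, by positivity, hFm, fun s hs => ?_, hasResidue_zero_of_analyticAt hFa⟩
  have hs' : (2 * n : ℝ) ≤ s.re := by
    have : (0 : ℝ) ≤ d := d.cast_nonneg
    linarith
  exact ⟨isTraceClass_of_summable (summable_norm_mul_absDiracPow _ _ hs'),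
    by rw [opTrace_eq_tsum S T q _ hs', (hFs s hs.le).tsum_eq]⟩

end NCTorus

end

open NCTorus
theorem mainTheorem8 (n : ℕ) (Θ : Matrix (Fin n) (Fin n) ℝ) (hΘ : Θ.transpose = -Θ)
    (S : SpinStructure n) :
    (∀ a : Fin n → Mode n → ℂ, (∀ α, IsSchwartz (a α)) → IsSelfAdjoint (oneForm Θ S a) →
      ∀ p q : ℕ, 1 ≤ q → q < n →
        HasNCIntegral (oneForm Θ S a ^ p * diracInv S ^ q) 0 ∧
        HasNCIntegral ((S.eps • conjJ S (oneForm Θ S a)) ^ p * diracInv S ^ q) 0) ∧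
    (1 < n → ∀ A ∈ oneForms Θ S, HasNCIntegral (A * diracInv S) 0) ∧
    (IsDiophantine ((2 * Real.pi)⁻¹ • Θ) →
      ∀ B ∈ bigAlg Θ S, ∀ q : ℕ, 1 ≤ q → q < n → HasNCIntegral (B * diracInv S ^ q) 0) := by
  have hl := hasSmallDivisorBound_leftModes Θ
  refine ⟨fun a ha _ p q _ hq => ⟨?_, ?_⟩, fun hn A hA => ?_, fun hD B hB q _ hq => ?_⟩
  · exact hasNCIntegral_zero S hl (pow_mem (oneForm_mem Θ S ha) p) hq
  · exact hasNCIntegral_zero S (hasSmallDivisorBound_rightModes Θ)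
      (pow_mem (Subalgebra.smul_mem _ (conjJ_mem_smoothAlg S (oneForm_mem Θ S ha)) _) p) hq
  · simpa only [pow_one] using hasNCIntegral_zero S hl (oneForms_le Θ S hA) hn
  · exact hasNCIntegral_zero S (hD.hasSmallDivisorBound hΘ) (bigAlg_le Θ S hB) hq
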